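/- Let $S$ be a regular semigroup (every $x\in S$ has an inverse $x'$: $xx'x=x$, $x'xx'=x'$), and let $E$ be its set of idempotents. For $e,f\in E$ write $e\,\omega^l f$ if $ef=e$, $e\,\omega^r f$ if $fe=e$, $\omega=\omega^l\cap\omega^r$, $\mathscr L=\omega^l\cap(\omega^l)^{-1}$, $\mathscr R=\omega^r\cap(\omega^r)^{-1}$. The inductive groupoid $\mathcal G(S)$ has object set $E$; its morphisms $e\to f$ are the pairs $(x,x')$ of mutually inverse elements with $xx'=e$, $x'x=f$, and $(x,x')(y,y')=(xy,y'x')$. *Normal categories.* A category with subobjects is a small category $\mathcal C$ with a wide subcategory $\mathcal P$ of "inclusions" which is a strict preorder, consists of monomorphisms, and satisfies: $hg\in\mathcal P$ and $g\in\mathcal P$ imply $h\in\mathcal P$. A retraction is a morphism $q$ with $jq=1$ for some inclusion $j$ (composition is written from left to right). A normal cone with apex $d$ is a family $\gamma(c)\colon c\to d$ ($c\in v\mathcal C$) with $j\gamma(c')=\gamma(c)$ for every inclusion $j\colon c\to c'$ and with at least one component an isomorphism. $\mathcal C$ is normal if every morphism is a product $f=quj$ of a retraction, an isomorphism and an inclusion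 (then $f^\circ=qu$ depends only on $f$), every inclusion splits, and each object $c$ is the apex of a normal cone $\gamma$ with $\gamma(c)=1_c$. Normal cones are multiplied by $\gamma\cdot\sigma=\gamma*\sigma(c_\gamma)^\circ$, where $c_\gamma$ is the apex of $\gamma$ and $(\gamma*f^\circ)(a)=\gamma(a)f^\circ$. Put $H(\gamma;c)=\{\gamma*f^\circ: f\in\mathcal C(c_\gamma,c)\}$ and $H(\gamma;g)\colon\gamma*f^\circ\mapsto\gamma*(fg)^\circ$, and let $\eta_\gamma\colon H(\gamma;-)\to\mathcal C(c_\gamma,-)$, $\gamma*f^\circ\mapsto f$. The normal dual $N^*\mathcal C$ is the full subcategory of $[\mathcal C,\mathbf{Set}]$ on the functors $H(\gamma;-)$, its inclusions being the inclusions of subfunctors; $MH(\gamma;-)$ is the set of objects $c$ for which $\gamma(c)$ is an isomorphism. *Cross-connections.* A cross-connection $(\mathcal D,\mathcal C;\Gamma)$ of normal categories is a functor $\Gamma\colon\mathcal D\to N^*\mathcal C$ that is inclusion preserving, fully faithful, maps for each $d$ the full subcategory on the subobjects of $d$ isomorphically onto that on the subobjects of $\Gamma(d)$, and is such that every $c\in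 v\mathcal C$ lies in $M\Gamma(d)$ for some $d$. Let $E_\Gamma=\{(c,d): c\in M\Gamma(d)\}$, and for $(c,d)\in E_\Gamma$ let $\gamma(c,d)$ be the unique idempotent normal cone in $\mathcal C$ with apex $c$ and $H(\gamma(c,d);-)=\Gamma(d)$. The dual of $\Gamma$ is the cross-connection $\Delta\colon\mathcal C\to N^*\mathcal D$ such that, writing $\delta(c,d)$ for the corresponding idempotent cones of $\Delta$: $(d,c)\in E_\Delta\iff(c,d)\in E_\Gamma$; for $(c,d),(c',d')\in E_\Gamma$, $f\colon c\to c'$ and $g\colon d'\to d$, one has $\Delta(f)\,\eta_{\delta(c',d')}=\eta_{\delta(c,d)}\,\mathcal D(g,-)$ if and only if $\Gamma(g)\,\eta_{\gamma(c,d)}=\eta_{\gamma(c',d')}\,\mathcal C(f,-)$ (in this case $g=f^*$ is called the transpose of $f$); and $\delta(c,d)(d')=(\gamma(c',d')(c))^*$. A morphism from $(\mathcal D,\mathcal C;\Gamma)$ to $(\mathcal D',\mathcal C';\Gamma')$ is a pair of inclusion preserving functors $F\colon\mathcal C\to\mathcal C'$, $G\colon\mathcal D\to\mathcal D'$ such that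 (M1) $(c,d)\in E_\Gamma$ implies $(F(c),G(d))\in E_{\Gamma'}$ and $F(\gamma(c,d)(c'))=\gamma(F(c),G(d))(F(c'))$ for all $c'\in v\mathcal C$; (M2) if $(c,d),(c',d')\in E_\Gamma$ and $f^*\colon d'\to d$ is the transpose of $f\colon c\to c'$, then $G(f^*)=F(f)^*$. It is an isomorphism if it has an inverse morphism. *The cross-connection of $S$.* $\mathcal L_S$ is the category of the principal left ideals $Se$ ($e\in E$), with the morphisms $\rho(e,u,f)\colon Se\to Sf$, $x\mapsto xu$ ($u\in eSf$), and with the set inclusions $Se\subseteq Sf$ as inclusions. Dually, $\mathcal R_S$ is the category of the principal right ideals $eS$, with the morphisms $\lambda(e,u,f)\colon eS\to fS$, $x\mapsto ux$ ($u\in fSe$). With the cones $\rho^e(Sg)=\rho(g,ge,e)$ and $\lambda^e(gS)=\lambda(g,eg,e)$, the functor $\Gamma_S\colon\mathcal R_S\to N^*\mathcal L_S$ is given by $\Gamma_S(eS)=H(\rho^e;-)$, $\Gamma_S(\lambda(e,u,f))=\eta_{\rho^e}\,\mathcal L_S(\rho(f,u,e),-)\,\eta_{\rho^f}^{-1}$,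 and $\Delta_S\colon\mathcal L_S\to N^*\mathcal R_S$ is given dually by $\Delta_S(Se)=H(\lambda^e;-)$, $\Delta_S(\rho(e,u,f))=\eta_{\lambda^e}\,\mathcal R_S(\lambda(f,u,e),-)\,\eta_{\lambda^f}^{-1}$. *The cross-connection of $\mathcal G(S)$.* Let $\mathcal L_Q$ be the quiver with vertex set $E/\mathscr L$ whose arrows from the class $\overleftarrow e$ of $e$ to the class $\overleftarrow f$ of $f$ are the symbols $r(e,u,f)$ for which $u=e$ and $e\,\omega^l f$, or $u\in E$, $u\mathrel{\mathscr L}f$ and $u\,\omega\,e$, or $(u,u')\colon e\to f$ is a morphism of $\mathcal G(S)$ for some $u'$. Write the morphisms of the free category on $\mathcal L_Q$ as symbols $r(e,u,f)$ by means of $r(e,u,f)\,r(g,v,h)=r(e,uv,h)$ (for $f\mathrel{\mathscr L}g$) and $1_{\overleftarrow e}=r(e,e,e)$. The category $\mathcal L_G$ is the quotient of the free category by the relation $r(e,u,f)\sim r(g,v,h)\iff e\mathrel{\mathscr L}g,\ f\mathrel{\mathscr L}h,\ u=ev$; its inclusions are the morphisms $r(e,e,f)$ with $e\,\omega^l f$.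 It contains a morphism $r(e,u,f)$ for every $u\in eSf$. The category $\mathcal R_G$, with objects the classes $\overrightarrow e$ in $E/\mathscr R$ and morphisms $l(e,u,f)$ ($u\in fSe$), is obtained by the dual construction (from the opposite semigroup), a morphism $(x,x')\colon e\to f$ of $\mathcal G(S)$ giving the arrow $l(e,x',f)$. With the cones $r^e(\overleftarrow g)=r(g,ge,e)$ and $l^e(\overrightarrow g)=l(g,eg,e)$, the functors $\Gamma_G\colon\mathcal R_G\to N^*\mathcal L_G$ and $\Delta_G\colon\mathcal L_G\to N^*\mathcal R_G$ are given by $\Gamma_G(\overrightarrow e)=H(r^e;-)$, $\Gamma_G(l(e,u,f))=\eta_{r^e}\,\mathcal L_G(r(f,u,e),-)\,\eta_{r^f}^{-1}$, $\Delta_G(\overleftarrow e)=H(l^e;-)$ and $\Delta_G(r(e,u,f))=\eta_{l^e}\,\mathcal R_G(l(f,u,e),-)\,\eta_{l^f}^{-1}$. **Theorem.** $\mathcal L_G,\mathcal R_G,\mathcal L_S,\mathcal R_S$ are normal categories; $(\mathcal R_G,\mathcal L_G;\Gamma_G)$ and $(\mathcal R_S,\mathcal L_S;\Gamma_S)$ are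 cross-connections with duals $\Delta_G$ and $\Delta_S$; the functors $\mathfrak L\colon\mathcal L_G\to\mathcal L_S$, $\mathfrak L(\overleftarrow e)=Se$, $\mathfrak L(r(e,u,f))=\rho(e,u,f)$, and $\mathfrak R\colon\mathcal R_G\to\mathcal R_S$, $\mathfrak R(\overrightarrow e)=eS$, $\mathfrak R(l(e,u,f))=\lambda(e,u,f)$, are isomorphisms of normal categories; and $(\mathfrak L,\mathfrak R)$ is an isomorphism of cross-connections from $(\mathcal R_G,\mathcal L_G;\Gamma_G)$ onto $(\mathcal R_S,\mathcal L_S;\Gamma_S)$, that is, it satisfies (M1) and (M2) and has an inverse morphism of cross-connections. -/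

import Mathlib

open CategoryTheory

universe u v

namespace CrossConn

/-! ### Categories with subobjects, normal categories -/

/-- The data of a distinguished class `𝒫` of morphisms, the inclusions. -/
class Inclusions (C : Type u) [Category.{v} C] where
  incl : ∀ {a b : C}, (a ⟶ b) → Prop

open Inclusions (incl)

/-- `a ⊆ b`: there is an inclusion from `a` to `b`. -/
def Sub {C : Type u} [Category.{v} C] [Inclusions C] (a b : C) : Prop :=
  ∃ j : a ⟶ b, incl j

/-- `(C, 𝒫)` is a category with subobjects: the inclusions form a wide subcategory which is a
strict preorder, they are monomorphisms, and `h ≫ g ∈ 𝒫`, `g ∈ 𝒫` imply `h ∈ 𝒫`. -/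
class CategoryWithSubobjects (C : Type u) [Category.{v} C] [Inclusions C] : Prop where
  incl_id : ∀ a : C, incl (𝟙 a)
  incl_comp : ∀ {a b c : C} (f : a ⟶ b) (g : b ⟶ c), incl f → incl g → incl (f ≫ g)
  incl_unique : ∀ {a b : C} (f g : a ⟶ b), incl f → incl g → f = g
  incl_antisymm : ∀ {a b : C} (f : a ⟶ b) (g : b ⟶ a), incl f → incl g → a = b
  incl_mono : ∀ {a b : C} (f : a ⟶ b), incl f → Mono f
  incl_of_comp : ∀ {a b c : C} (h : a ⟶ b) (g : b ⟶ c), incl g → incl (h ≫ g) → incl h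

section

variable {C : Type u} [Category.{v} C] [Inclusions C]

/-- `q : c ⟶ c'` is a retraction: `c' ⊆ c` and `j(c', c) ≫ q = 𝟙`. -/
def IsRetraction {c c' : C} (q : c ⟶ c') : Prop :=
  ∃ j : c' ⟶ c, incl j ∧ j ≫ q = 𝟙 c'

/-- A normal factorization `f = q u j` of `f : c ⟶ d`: a retraction, an isomorphism, and an
inclusion. -/
structure NormalFactorization {c d : C} (f : c ⟶ d) where
  {c' : C}
  {d' : C}
  q : c ⟶ c'
  u : c' ⟶ d'
  j : d' ⟶ d
  retraction : IsRetraction q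
  iso : IsIso u
  inclusion : incl j
  fac : q ≫ u ≫ j = f

/-- A normal cone with apex `d`. -/
@[ext]
structure NormalCone (d : C) where
  comp : ∀ c : C, c ⟶ d
  incl_comp : ∀ {c c' : C} (j : c ⟶ c'), incl j → j ≫ comp c' = comp c
  exists_iso : ∃ c : C, IsIso (comp c)

end

/-- The set `TC` of all normal cones in `C`. -/
abbrev TC (C : Type u) [Category.{v} C] [Inclusions C] : Type (max u v) :=
  Σ d : C, NormalCone d

/-- Normal categories. -/
class NormalCategory (C : Type u) [Category.{v} C] [Inclusions C] : Prop
    extends CategoryWithSubobjects C where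
  normal_factorization : ∀ {c d : C} (f : c ⟶ d), Nonempty (NormalFactorization f)
  incl_splits : ∀ {c d : C} (j : c ⟶ d), incl j → ∃ q : d ⟶ c, j ≫ q = 𝟙 c
  exists_cone : ∀ c : C, ∃ γ : NormalCone c, γ.comp c = 𝟙 c

/-! ### The semigroup of normal cones, H-functors, the normal dual -/

section

variable {C : Type u} [Category.{v} C] [Inclusions C] [NormalCategory C]

/-- A chosen normal factorization of `f`.  (The object `im f` and the epimorphic component do not
depend on the choice.) -/
noncomputable def factor {c d : C} (f : c ⟶ d) : NormalFactorization f :=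
  (NormalCategory.normal_factorization f).some

/-- The codomain of the epimorphic component of `f`. -/
noncomputable abbrev im {c d : C} (f : c ⟶ d) : C := (factor f).d'

/-- The epimorphic component `f° = q u` of `f = q u j`. -/
noncomputable def epi {c d : C} (f : c ⟶ d) : c ⟶ im f := (factor f).q ≫ (factor f).u

/-- The inclusion part `j` of `f = q u j`. -/
noncomputable def imIncl {c d : C} (f : c ⟶ d) : im f ⟶ d := (factor f).j

theorem imIncl_incl {c d : C} (f : c ⟶ d) : incl (imIncl f) := (factor f).inclusion

theorem epi_imIncl {c d : C} (f : c ⟶ d) : epi f ≫ imIncl f = f := by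
  rw [epi, imIncl, Category.assoc]
  exact (factor f).fac

/-- A monomorphism is, up to an isomorphism, an inclusion. -/
theorem mono_factor {c d : C} (f : c ⟶ d) [Mono f] :
    ∃ (d' : C) (u : c ⟶ d') (j : d' ⟶ d), IsIso u ∧ incl j ∧ u ≫ j = f := by
  obtain ⟨F⟩ := NormalCategory.normal_factorization f
  obtain ⟨i, hi, hiq⟩ := F.retraction
  have := F.iso
  have : Mono F.q := by
    have := F.fac
    have : Mono (F.q ≫ F.u ≫ F.j) := by rw [this]; infer_instance
    exact mono_of_mono F.q (F.u ≫ F.j)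
  have : IsIso F.q := ⟨i, by
    rw [← cancel_mono F.q, Category.assoc, hiq, Category.comp_id, Category.id_comp], hiq⟩
  exact ⟨_, F.q ≫ F.u, F.j, inferInstance, F.inclusion, by simpa using F.fac⟩

/-- The normal cone `γ * f°` with apex `im f`, whose component at `a` is `γ(a) f°`. -/
noncomputable def star {c d : C} (γ : NormalCone c) (f : c ⟶ d) : NormalCone (im f) where
  comp a := γ.comp a ≫ epi f
  incl_comp j hj := by rw [← Category.assoc, γ.incl_comp j hj]
  exists_iso := by
    obtain ⟨a, ha⟩ := γ.exists_iso
    obtain ⟨i, hi, hiq⟩ := (factor f).retraction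
    have := (factor f).iso
    have := CategoryWithSubobjects.incl_mono i hi
    obtain ⟨b, w, k, hw, hk, hwk⟩ := mono_factor (i ≫ inv (γ.comp a))
    refine ⟨b, ?_⟩
    have h : γ.comp b ≫ epi f = inv w ≫ (factor f).u := by
      rw [← γ.incl_comp k hk, IsIso.eq_inv_comp]
      simp only [← Category.assoc, hwk]
      simp [epi, reassoc_of% hiq]
    rw [h]
    exact inferInstanceAs (IsIso (inv w ≫ (factor f).u))

/-- The product `γ · σ = γ * (σ(c_γ))°` of normal cones. -/
noncomputable instance : Mul (TC C) where
  mul γ σ := ⟨_, star γ.2 (σ.2.comp γ.1)⟩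

theorem star_comp_imIncl {c d : C} (γ : NormalCone c) (f : c ⟶ d) (a : C) :
    (star γ f).comp a ≫ imIncl f = γ.comp a ≫ f := by
  simp [star, epi_imIncl]

theorem NormalCone.cancel {C : Type u} [Category.{v} C] [Inclusions C] {c d : C} (γ : NormalCone c) (f g : c ⟶ d)
    (h : ∀ a, γ.comp a ≫ f = γ.comp a ≫ g) : f = g := by
  obtain ⟨a, ha⟩ := γ.exists_iso
  exact (cancel_epi (γ.comp a)).1 (h a)

/-- A normal cone is determined by its components, viewed in any larger object. -/
theorem cone_ext {c c' d : C} (σ : NormalCone c) (σ' : NormalCone c') (j : c ⟶ d) (j' : c' ⟶ d)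
    (hj : incl j) (hj' : incl j') (h : ∀ a, σ.comp a ≫ j = σ'.comp a ≫ j') :
    (⟨c, σ⟩ : TC C) = ⟨c', σ'⟩ := by
  have key : ∀ {c c' : C} (σ : NormalCone c) (σ' : NormalCone c') (j : c ⟶ d) (j' : c' ⟶ d),
      incl j → incl j' → (∀ a, σ.comp a ≫ j = σ'.comp a ≫ j') → Sub c c' := by
    intro c c' σ σ' j j' hj hj' h
    obtain ⟨a, ha⟩ := σ.exists_iso
    refine ⟨inv (σ.comp a) ≫ σ'.comp a, CategoryWithSubobjects.incl_of_comp _ j' hj' ?_⟩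
    rw [Category.assoc, ← h a, IsIso.inv_hom_id_assoc]
    exact hj
  obtain ⟨i, hi⟩ := key σ σ' j j' hj hj' h
  obtain ⟨i', hi'⟩ := key σ' σ j' j hj' hj (fun a => (h a).symm)
  obtain rfl := CategoryWithSubobjects.incl_antisymm i i' hi hi'
  obtain rfl := CategoryWithSubobjects.incl_unique j j' hj hj'
  have := CategoryWithSubobjects.incl_mono j hj
  have : σ = σ' := NormalCone.ext (funext fun a => (cancel_mono j).1 (h a))
  rw [this]

theorem star_injective {c d : C} (γ : NormalCone c) :
    Function.Injective fun f : c ⟶ d => (⟨im f, star γ f⟩ : TC C) := by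
  intro f g h
  have key : ∀ (σ τ : TC C) (i : σ.1 ⟶ d) (j : τ.1 ⟶ d), σ = τ → incl i → incl j →
      ∀ a, σ.2.comp a ≫ i = τ.2.comp a ≫ j := by
    rintro σ τ i j rfl hi hj a
    rw [CategoryWithSubobjects.incl_unique i j hi hj]
  refine γ.cancel f g fun a => ?_
  rw [← star_comp_imIncl γ f, ← star_comp_imIncl γ g]
  exact key ⟨_, star γ f⟩ ⟨_, star γ g⟩ _ _ h (imIncl_incl f) (imIncl_incl g) a

end

/-- A functor from `C` to sets all of whose values are subsets of `U`. -/
@[ext]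
structure SubsetFunctor (C : Type u) [Category.{v} C] (U : Type (max u v)) where
  obj : C → Set U
  map : ∀ {c d : C}, (c ⟶ d) → obj c → obj d
  map_id : ∀ (c : C) (x : obj c), map (𝟙 c) x = x
  map_comp : ∀ {c d e : C} (f : c ⟶ d) (g : d ⟶ e) (x : obj c), map (f ≫ g) x = map g (map f x)

theorem SubsetFunctor.ext_of {C : Type u} [Category.{v} C] {U : Type (max u v)}
    {F G : SubsetFunctor C U} (h : ∀ c, F.obj c = G.obj c)
    (h' : ∀ {c d : C} (g : c ⟶ d) (x : U) (hx : x ∈ F.obj c) (hx' : x ∈ G.obj c),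
      (F.map g ⟨x, hx⟩ : U) = G.map g ⟨x, hx'⟩) : F = G := by
  obtain ⟨o, m, _, _⟩ := F
  obtain ⟨o', m', _, _⟩ := G
  obtain rfl : o = o' := funext h
  have : @m = @m' := by
    funext c d g x
    exact Subtype.ext (h' g x.1 x.2 x.2)
  subst this
  rfl

/-- The underlying functor from `C` to the category of sets. -/
def SubsetFunctor.toFunctor {C : Type u} [Category.{v} C] {U : Type (max u v)}
    (F : SubsetFunctor C U) : C ⥤ Type (max u v) where
  obj c := F.obj c
  map f := TypeCat.ofHom (F.map f)
  map_id c := by ext x; simp [F.map_id]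
  map_comp f g := by ext x; simp [F.map_comp]

section

variable {C : Type u} [Category.{u} C] [Inclusions C] [NormalCategory C]

/-- The set `H(γ; c) = {γ * f° : f ∈ C(c_γ, c)}`. -/
def Hset {a : C} (γ : NormalCone a) (c : C) : Set (TC C) :=
  Set.range fun f : a ⟶ c => (⟨im f, star γ f⟩ : TC C)

/-- The bijection `γ * f° ↔ f` between `H(γ; c)` and `C(c_γ, c)`. -/
noncomputable def Hequiv {a : C} (γ : NormalCone a) (c : C) : (a ⟶ c) ≃ Hset γ c :=
  Equiv.ofInjective _ (star_injective γ)

/-- The H-functor `H(γ; -)`, with `H(γ; g) : γ * f° ↦ γ * (f g)°`. -/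
noncomputable def H {a : C} (γ : NormalCone a) : SubsetFunctor C (TC C) where
  obj c := Hset γ c
  map {c d} g x := Hequiv γ d ((Hequiv γ c).symm x ≫ g)
  map_id c x := by simp
  map_comp f g x := by simp

theorem H_map_star {a : C} (γ : NormalCone a) {c d : C} (f : a ⟶ c) (g : c ⟶ d)
    (hx : (⟨im f, star γ f⟩ : TC C) ∈ (H γ).obj c) :
    (((H γ).map g ⟨_, hx⟩ : (H γ).obj d) : TC C) = ⟨im (f ≫ g), star γ (f ≫ g)⟩ := by
  have : (⟨_, hx⟩ : Hset γ c) = Hequiv γ c f := rfl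
  change ((Hequiv γ d ((Hequiv γ c).symm ⟨_, hx⟩ ≫ g) : Hset γ d) : TC C) = _
  rw [this, Equiv.symm_apply_apply]
  rfl

/-- Cones which differ by morphisms of their apices have the same H-functor. -/
theorem H_eq_of {a a' : C} (γ : NormalCone a) (γ' : NormalCone a') (θ : a ⟶ a') (θ' : a' ⟶ a)
    (h : ∀ x, γ'.comp x = γ.comp x ≫ θ) (h' : ∀ x, γ.comp x = γ'.comp x ≫ θ') : H γ = H γ' := by
  have key : ∀ {a a' : C} (γ : NormalCone a) (γ' : NormalCone a') (θ' : a' ⟶ a),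
      (∀ x, γ.comp x = γ'.comp x ≫ θ') → ∀ {c : C} (f : a ⟶ c),
      (⟨im f, star γ f⟩ : TC C) = ⟨im (θ' ≫ f), star γ' (θ' ≫ f)⟩ := by
    intro a a' γ γ' θ' h' c f
    refine cone_ext _ _ (imIncl _) (imIncl _) (imIncl_incl _) (imIncl_incl _) fun x => ?_
    rw [star_comp_imIncl, star_comp_imIncl, h', Category.assoc]
  refine SubsetFunctor.ext_of (fun c => ?_) ?_
  · ext σ
    constructor
    · rintro ⟨f, rfl⟩
      exact ⟨_, (key γ γ' θ' h' f).symm⟩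
    · rintro ⟨f, rfl⟩
      exact ⟨_, (key γ' γ θ h f).symm⟩
  · rintro c d g _ ⟨f, rfl⟩ hx'
    have e := key γ γ' θ' h' f
    have hm : ∀ (x y : TC C) (hx : x ∈ (H γ').obj c) (hy : y ∈ (H γ').obj c), x = y →
        ((H γ').map g ⟨x, hx⟩ : TC C) = (H γ').map g ⟨y, hy⟩ := by
      rintro x y hx hy rfl
      rfl
    refine (H_map_star γ f g _).trans (Eq.trans ?_ (hm _ _ hx' ⟨_, rfl⟩ e).symm)
    refine Eq.trans ?_ (H_map_star γ' (θ' ≫ f) g _).symm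
    rw [key γ γ' θ' h' (f ≫ g), Category.assoc]

/-- The natural isomorphism `η_γ : H(γ; -) ⟶ C(c_γ, -)`, `γ * f° ↦ f`. -/
noncomputable def eta {a : C} (γ : NormalCone a) :
    (H γ).toFunctor ≅ coyoneda.obj (Opposite.op a) :=
  NatIso.ofComponents (fun c => (Hequiv γ c).symm.toIso) (by
    intro c d g
    ext x
    exact (Hequiv γ d).symm_apply_apply _)

variable (C) in
/-- The normal dual `N*C`: the full subcategory of `[C, Set]` on the H-functors. -/
@[ext]
structure NormalDual : Type u where
  fn : SubsetFunctor C (TC C)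
  exists_eq : ∃ (a : C) (γ : NormalCone a), fn = H γ

/-- The morphisms of the normal dual are the natural transformations. -/
@[ext]
structure NormalDual.Hom (F G : NormalDual C) where
  nat : F.fn.toFunctor ⟶ G.fn.toFunctor

instance : Category.{u} (NormalDual C) where
  Hom F G := NormalDual.Hom F G
  id F := ⟨𝟙 F.fn.toFunctor⟩
  comp f g := ⟨f.nat ≫ g.nat⟩

/-- The object `H(γ; -)` of the normal dual. -/
noncomputable abbrev NormalDual.of {a : C} (γ : NormalCone a) : NormalDual C := ⟨H γ, a, γ, rfl⟩

/-- The component at `c` of a morphism of the normal dual, as a function. -/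
def NormalDual.apply {F G : NormalDual C} (m : F ⟶ G) (c : C) (x : F.fn.obj c) : G.fn.obj c :=
  (m.nat.app c).hom.toFun x

/-- The inclusions of the normal dual are the inclusions of subfunctors. -/
instance : Inclusions (NormalDual C) where
  incl {F _} m := ∀ (c : C) (x : F.fn.obj c),
    (NormalDual.apply m c x : TC C) = x

/-- The M-set of an H-functor `H(γ; -)`: the objects `c` for which `γ(c)` is an isomorphism. -/
def MSet (F : NormalDual C) : Set C :=
  {c | ∃ (a : C) (γ : NormalCone a), F = NormalDual.of γ ∧ IsIso (γ.comp c)}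

end

/-! ### Cross-connections, duals, transposes, morphisms -/

section

variable {C D : Type u} [Category.{u} C] [Inclusions C] [Category.{u} D] [Inclusions D]

/-- `F` maps inclusions to inclusions. -/
def InclusionPreserving (F : C ⥤ D) : Prop :=
  ∀ {a b : C} (j : a ⟶ b), incl j → incl (F.map j)

/-- `F` is inclusion preserving, fully faithful, and for each `c` restricts to an isomorphism of
the ideal `⟨c⟩` onto the ideal `⟨F c⟩`.  Ideals are full subcategories, so for fully faithful `F`
the last condition is bijectivity on the objects of the ideals. -/
structure IsLocalIsomorphism (F : C ⥤ D) : Prop where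
  inclusionPreserving : InclusionPreserving F
  full : F.Full
  faithful : F.Faithful
  ideal_bijOn : ∀ c : C, Set.BijOn F.obj {c' | Sub c' c} {d | Sub d (F.obj c)}

/-- `F` is an isomorphism of normal categories. -/
structure IsNormalCategoryIso (F : C ⥤ D) : Prop where
  obj_bijective : Function.Bijective F.obj
  full : F.Full
  faithful : F.Faithful
  incl_iff : ∀ {a b : C} (j : a ⟶ b), incl (F.map j) ↔ incl j

end

section

variable {C D : Type u} [Category.{u} C] [Inclusions C] [NormalCategory C] [Category.{u} D]

/-- `(c, d) ∈ E_Γ`, that is, `c ∈ MΓ(d)`. -/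
def EGamma (Γ : D ⥤ NormalDual C) (c : C) (d : D) : Prop := c ∈ MSet (Γ.obj d)

/-- `(D, C; Γ)` is a cross-connection. -/
structure IsCrossConnection [Inclusions D] (Γ : D ⥤ NormalDual C) : Prop where
  localIso : IsLocalIsomorphism Γ
  exists_mem : ∀ c : C, ∃ d : D, EGamma Γ c d

theorem exists_idempotent_cone {F : NormalDual C} {c : C} (h : c ∈ MSet F) :
    ∃ ε : NormalCone c, IsIdempotentElem (⟨c, ε⟩ : TC C) ∧ F = NormalDual.of ε := by
  obtain ⟨a, γ, rfl, hc⟩ := h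
  let ε : NormalCone c :=
    { comp := fun x => γ.comp x ≫ inv (γ.comp c)
      incl_comp := fun j hj => by rw [← Category.assoc, γ.incl_comp j hj]
      exists_iso := ⟨c, by simp only [IsIso.hom_inv_id]; infer_instance⟩ }
  refine ⟨ε, ?_, ?_⟩
  · change (⟨_, star ε (ε.comp c)⟩ : TC C) = ⟨c, ε⟩
    refine cone_ext _ _ (imIncl _) (𝟙 c) (imIncl_incl _) (CategoryWithSubobjects.incl_id c)
      fun a => ?_
    rw [star_comp_imIncl]
    simp [ε]
  · exact NormalDual.ext (H_eq_of γ ε (inv (γ.comp c)) (γ.comp c) (fun _ => rfl)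
      (fun x => by simp [ε]))

/-- For `(c, d) ∈ E_Γ`, the (unique) idempotent cone `γ(c, d) ∈ TC` with apex `c` and
`H(γ(c, d); -) = Γ(d)`. -/
noncomputable def gammaCone {Γ : D ⥤ NormalDual C} {c : C} {d : D} (h : EGamma Γ c d) :
    NormalCone c :=
  (exists_idempotent_cone h).choose

theorem gammaCone_spec {Γ : D ⥤ NormalDual C} {c : C} {d : D} (h : EGamma Γ c d) :
    IsIdempotentElem (⟨c, gammaCone h⟩ : TC C) ∧ Γ.obj d = NormalDual.of (gammaCone h) :=
  (exists_idempotent_cone h).choose_spec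

/-- The natural isomorphism `η_{γ(c, d)} : Γ(d) ⟶ C(c, -)`. -/
noncomputable def etaGamma {Γ : D ⥤ NormalDual C} {c : C} {d : D} (h : EGamma Γ c d) :
    (Γ.obj d).fn.toFunctor ≅ coyoneda.obj (Opposite.op c) :=
  eqToIso (by rw [(gammaCone_spec h).2]) ≪≫ eta (gammaCone h)

/-- For `(c, d), (c', d') ∈ E_Γ`, `g : d ⟶ d'` and `f : c' ⟶ c`, the square with sides
`Γ(g) : Γ(d) ⟶ Γ(d')`, `C(f, -) : C(c, -) ⟶ C(c', -)`, `η_{γ(c, d)} : Γ(d) ⟶ C(c, -)` and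
`η_{γ(c', d')} : Γ(d') ⟶ C(c', -)` commutes. -/
def CommSquare (Γ : D ⥤ NormalDual C) {c c' : C} {d d' : D} (h : EGamma Γ c d)
    (h' : EGamma Γ c' d') (g : d ⟶ d') (f : c' ⟶ c) : Prop :=
  (Γ.map g).nat ≫ (etaGamma h').hom = (etaGamma h).hom ≫ coyoneda.map f.op

variable [Inclusions D] [NormalCategory D]

/-- `Δ : C ⥤ N*D` is the dual of the cross-connection `Γ : D ⥤ N*C`: it is a cross-connection
with `(d, c) ∈ E_Δ ↔ (c, d) ∈ E_Γ`; a pair of morphisms `f : c ⟶ c'`, `g : d' ⟶ d` makes the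
square of `Γ` commute if and only if it makes the square of `Δ` commute; and
the component at `d'` of the idempotent cone `δ(c, d) ∈ TD` corresponds in this way to the
component at `c` of the idempotent cone `γ(c', d') ∈ TC`. These conditions determine `Δ`. -/
structure IsDual (Γ : D ⥤ NormalDual C) (Δ : C ⥤ NormalDual D) : Prop where
  isCrossConnection : IsCrossConnection Δ
  mem_iff : ∀ (c : C) (d : D), EGamma Δ d c ↔ EGamma Γ c d
  square_iff : ∀ {c c' : C} {d d' : D} (h : EGamma Γ c d) (h' : EGamma Γ c' d')
    (k : EGamma Δ d c) (k' : EGamma Δ d' c') (f : c ⟶ c') (g : d' ⟶ d),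
    CommSquare Δ k k' f g ↔ CommSquare Γ h' h g f
  cone_comp : ∀ {c c' : C} {d d' : D} (h : EGamma Γ c d) (h' : EGamma Γ c' d')
    (k : EGamma Δ d c),
    CommSquare Γ h' h ((gammaCone k).comp d') ((gammaCone h').comp c)

/-- For `(c, d), (c', d') ∈ E_Γ`, the morphism `g : d' ⟶ d` is the transpose `f*` of
`f : c ⟶ c'`: the square formed by `Δ(f)`, `D(g, -)`, `η_{δ(c, d)}` and `η_{δ(c', d')}`
commutes, where `Δ` is the dual of `Γ`. -/
def IsTranspose (Δ : C ⥤ NormalDual D) {c c' : C} {d d' : D} (f : c ⟶ c') (g : d' ⟶ d) : Prop :=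
  ∃ (k : EGamma Δ d c) (k' : EGamma Δ d' c'), CommSquare Δ k k' f g

end

section

variable {C D C' D' : Type u}
  [Category.{u} C] [Inclusions C] [NormalCategory C]
  [Category.{u} D] [Inclusions D] [NormalCategory D]
  [Category.{u} C'] [Inclusions C'] [NormalCategory C']
  [Category.{u} D'] [Inclusions D'] [NormalCategory D']

/-- `(F, G)` is a morphism from the cross-connection `(D, C; Γ)` with dual `Δ` to the
cross-connection `(D', C'; Γ')` with dual `Δ'`. -/
structure IsCrossConnectionMorphism (Γ : D ⥤ NormalDual C) (Δ : C ⥤ NormalDual D)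
    (Γ' : D' ⥤ NormalDual C') (Δ' : C' ⥤ NormalDual D') (F : C ⥤ C') (G : D ⥤ D') : Prop where
  inclusionPreserving_left : InclusionPreserving F
  inclusionPreserving_right : InclusionPreserving G
  /-- (M1), first part -/
  map_mem : ∀ {c : C} {d : D}, EGamma Γ c d → EGamma Γ' (F.obj c) (G.obj d)
  /-- (M1), second part -/
  map_cone : ∀ {c : C} {d : D} (h : EGamma Γ c d) (c' : C),
    F.map ((gammaCone h).comp c') = (gammaCone (map_mem h)).comp (F.obj c')
  /-- (M2) -/
  map_transpose : ∀ {c c' : C} {d d' : D}, EGamma Γ c d → EGamma Γ c' d' →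
    ∀ (f : c ⟶ c') (g : d' ⟶ d), IsTranspose Δ f g → IsTranspose Δ' (F.map f) (G.map g)

/-- `(F, G)` is an isomorphism of cross-connections: it is a morphism which has an inverse
morphism. -/
def IsCrossConnectionIso (Γ : D ⥤ NormalDual C) (Δ : C ⥤ NormalDual D)
    (Γ' : D' ⥤ NormalDual C') (Δ' : C' ⥤ NormalDual D') (F : C ⥤ C') (G : D ⥤ D') : Prop :=
  IsCrossConnectionMorphism Γ Δ Γ' Δ' F G ∧
    ∃ (F' : C' ⥤ C) (G' : D' ⥤ D), IsCrossConnectionMorphism Γ' Δ' Γ Δ F' G' ∧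
      F ⋙ F' = 𝟭 C ∧ F' ⋙ F = 𝟭 C' ∧ G ⋙ G' = 𝟭 D ∧ G' ⋙ G = 𝟭 D'

end

/-! ### Regular semigroups and the inductive groupoid -/

/-- Every element of the semigroup has an inverse. -/
class IsRegularSemigroup (S : Type u) [Semigroup S] : Prop where
  exists_inverse : ∀ a : S, ∃ b : S, a * b * a = a ∧ b * a * b = b

instance (S : Type u) [Semigroup S] [IsRegularSemigroup S] : IsRegularSemigroup Sᵐᵒᵖ where
  exists_inverse a := by
    obtain ⟨b, h₁, h₂⟩ := IsRegularSemigroup.exists_inverse a.unop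
    refine ⟨MulOpposite.op b, MulOpposite.unop_injective ?_, MulOpposite.unop_injective ?_⟩
    · simpa [mul_assoc] using h₁
    · simpa [mul_assoc] using h₂

/-- The set `E(S)` of idempotents. -/
abbrev Idem (S : Type u) [Semigroup S] : Type u := {e : S // e * e = e}

section

variable {S : Type u} [Semigroup S]

/-- `e ω^l f`, that is, `e f = e`. -/
def OmegaL (e f : Idem S) : Prop := (e : S) * f = e

/-- `e ω^r f`, that is, `f e = e`. -/
def OmegaR (e f : Idem S) : Prop := (f : S) * e = e

/-- `e ω f`: the natural partial order on `E(S)`. -/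
def Omega (e f : Idem S) : Prop := OmegaL e f ∧ OmegaR e f

/-- Green's relation `ℒ` on `E(S)`. -/
def GreenL (e f : Idem S) : Prop := OmegaL e f ∧ OmegaL f e

/-- `u ∈ e S f`. -/
def Between (e : Idem S) (u : S) (f : Idem S) : Prop := ∃ s : S, u = e * s * f

theorem between_iff {e : Idem S} {u : S} {f : Idem S} :
    Between e u f ↔ (e : S) * u = u ∧ u * f = u := by
  constructor
  · rintro ⟨s, rfl⟩
    exact ⟨by rw [← mul_assoc, ← mul_assoc, e.2], by rw [mul_assoc, f.2]⟩
  · rintro ⟨h₁, h₂⟩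
    exact ⟨u, by rw [h₁, h₂]⟩

theorem GreenL.trans {e f g : Idem S} (h : GreenL e f) (h' : GreenL f g) : GreenL e g := by
  obtain ⟨h₁, h₂⟩ := h
  obtain ⟨h₃, h₄⟩ := h'
  unfold OmegaL at *
  refine ⟨?_, ?_⟩ <;> unfold OmegaL
  · rw [← h₁, mul_assoc, h₃]
  · rw [← h₄, mul_assoc, h₂]

variable (S) in
/-- Green's relation `ℒ` on `E(S)` as an equivalence relation. -/
def setoidL : Setoid (Idem S) where
  r := GreenL
  iseqv := ⟨fun e => ⟨e.2, e.2⟩, fun h => ⟨h.2, h.1⟩, GreenL.trans⟩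

variable (S) in
/-- The set `E/ℒ`. -/
abbrev EModL : Type u := Quotient (setoidL S)

/-- The canonical image of `e` in `E/ℒ`. -/
abbrev toEModL (e : Idem S) : EModL S := Quotient.mk (setoidL S) e

theorem toEModL_eq {e f : Idem S} : toEModL e = toEModL f ↔ GreenL e f :=
  Quotient.eq (r := setoidL S)

/-- A morphism `(x, x')` from `e = x x'` to `f = x' x` of the groupoid `𝒢(S)`: `x'` is an
inverse of `x`. -/
@[ext]
structure GHom (e f : Idem S) where
  x : S
  x' : S
  mul_mul : x * x' * x = x
  mul_mul' : x' * x * x' = x'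
  dom : x * x' = e
  cod : x' * x = f

variable (S) in
/-- The groupoid `𝒢(S)` of the regular semigroup `S`; its set of objects is `E(S)`. Of the
structure which makes it an inductive groupoid, the constructions below use the biordered set
`E(S)`, through `ω^l`, `ω^r` and `ω`. -/
structure IndGroupoid : Type u where
  as : Idem S

instance : Groupoid (IndGroupoid S) where
  Hom e f := GHom e.as f.as
  id e := ⟨e.as, e.as, by rw [e.as.2, e.as.2], by rw [e.as.2, e.as.2], e.as.2, e.as.2⟩
  comp {e f g} a b :=
    have h₁ : a.x * b.x * (b.x' * a.x') = e.as := by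
      rw [mul_assoc, ← mul_assoc b.x, b.dom, ← a.cod, ← mul_assoc, ← mul_assoc, a.mul_mul, a.dom]
    have h₂ : b.x' * a.x' * (a.x * b.x) = g.as := by
      rw [mul_assoc, ← mul_assoc a.x', a.cod, ← b.dom, ← mul_assoc, ← mul_assoc, b.mul_mul', b.cod]
    ⟨a.x * b.x, b.x' * a.x',
      by rw [h₁, ← a.dom, ← mul_assoc, a.mul_mul],
      by rw [h₂, ← b.cod, ← mul_assoc, b.mul_mul'], h₁, h₂⟩
  id_comp a := GHom.ext ((congrArg (· * a.x) a.dom).symm.trans a.mul_mul)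
    ((congrArg (a.x' * ·) a.dom).symm.trans ((mul_assoc _ _ _).symm.trans a.mul_mul'))
  comp_id a := GHom.ext ((congrArg (a.x * ·) a.cod).symm.trans
    ((mul_assoc _ _ _).symm.trans a.mul_mul)) ((congrArg (· * a.x') a.cod).symm.trans a.mul_mul')
  assoc a b c := GHom.ext (mul_assoc _ _ _) (mul_assoc _ _ _).symm
  inv a := ⟨a.x', a.x, a.mul_mul', a.mul_mul, a.cod, a.dom⟩
  inv_comp a := GHom.ext a.cod a.cod
  comp_inv a := GHom.ext a.dom a.dom

end

/-! ### The category `ℒ_S` of principal left ideals -/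

section

variable {S : Type u} [Semigroup S]

/-- The principal left ideal `S e`. -/
def leftIdeal (e : Idem S) : Set S := {x | ∃ s : S, x = s * e}

theorem mem_leftIdeal {e : Idem S} {x : S} : x ∈ leftIdeal e ↔ x * e = x :=
  ⟨by rintro ⟨s, rfl⟩; rw [mul_assoc, e.2], fun h => ⟨x, h.symm⟩⟩

theorem leftIdeal_eq {e f : Idem S} : leftIdeal e = leftIdeal f ↔ GreenL e f := by
  constructor
  · intro h
    exact ⟨mem_leftIdeal.1 (h ▸ mem_leftIdeal.2 e.2), mem_leftIdeal.1 (h ▸ mem_leftIdeal.2 f.2)⟩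
  · rintro ⟨h₁, h₂⟩
    unfold OmegaL at h₁ h₂
    ext x
    rw [mem_leftIdeal, mem_leftIdeal]
    constructor
    · intro h
      rw [← h, mul_assoc, h₁]
    · intro h
      rw [← h, mul_assoc, h₂]

variable (S) in
/-- The objects of `ℒ_S`: the principal left ideals `S e`, `e ∈ E(S)`. -/
structure LS : Type u where
  carrier : Set S
  exists_idem : ∃ e : Idem S, leftIdeal e = carrier

/-- The object `S e` of `ℒ_S`. -/
def LS.of (e : Idem S) : LS S := ⟨leftIdeal e, e, rfl⟩

/-- The morphisms of `ℒ_S`: the partial right translations `ρ(e, u, f) : S e → S f`, `x ↦ x u`,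
with `u ∈ e S f`. -/
@[ext]
structure LS.Hom (A B : LS S) where
  toFun : A.carrier → B.carrier
  exists_eq : ∃ (e : Idem S) (u : S) (f : Idem S), leftIdeal e = A.carrier ∧
    leftIdeal f = B.carrier ∧ Between e u f ∧ ∀ x, (toFun x : S) = x * u

instance : Category.{u} (LS S) where
  Hom A B := LS.Hom A B
  id A := ⟨id, by
    obtain ⟨e, he⟩ := A.exists_idem
    exact ⟨e, e, e, he, he, ⟨e, by rw [e.2, e.2]⟩,
      fun x => (mem_leftIdeal.1 (he.symm.subset x.2)).symm⟩⟩
  comp φ ψ := ⟨ψ.toFun ∘ φ.toFun, by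
    obtain ⟨e, u, f, he, hf, hu, hφ⟩ := φ.exists_eq
    obtain ⟨g, v, h, hg, hh, hv, hψ⟩ := ψ.exists_eq
    refine ⟨e, u * v, h, he, hh, between_iff.2 ⟨?_, ?_⟩, fun x => ?_⟩
    · rw [← mul_assoc, (between_iff.1 hu).1]
    · rw [mul_assoc, (between_iff.1 hv).2]
    · rw [Function.comp_apply, hψ, hφ, mul_assoc]⟩

/-- The inclusions of `ℒ_S` are the inclusions `S e ⊆ S f` of sets. -/
instance : Inclusions (LS S) where
  incl {A _} φ := ∀ x : A.carrier, (LS.Hom.toFun φ x : S) = x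

/-- The morphism `ρ(e, u, f)`. -/
def LS.rho {A B : LS S} (e : Idem S) (u : S) (f : Idem S) (he : LS.of e = A) (hf : LS.of f = B)
    (hu : Between e u f) : A ⟶ B :=
  ⟨fun x => ⟨x * u, by
    subst hf
    exact mem_leftIdeal.2 (by rw [mul_assoc, (between_iff.1 hu).2])⟩,
    e, u, f, congrArg LS.carrier he, congrArg LS.carrier hf, hu, fun _ => rfl⟩

theorem LS.hom_ext {A B : LS S} {φ ψ : A ⟶ B}
    (h : ∀ x : A.carrier, (LS.Hom.toFun φ x : S) = LS.Hom.toFun ψ x) : φ = ψ :=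
  LS.Hom.ext (funext fun x => Subtype.ext (h x))

variable (S) in
/-- The category `ℛ_S` of principal right ideals of `S`, that is, the category of principal left
ideals of the opposite semigroup. The morphism `λ(e, u, f)`, `u ∈ f S e`, from `e S` to `f S` is
the morphism `ρ(e, u, f)` of the opposite semigroup. -/
abbrev RS : Type u := LS Sᵐᵒᵖ

end

/-! ### The category `ℒ_G` built from the inductive groupoid -/

section

variable {S : Type u} [Semigroup S]

/-- `r(e, u, f)` is a morphism `j(e, f) = r(e, e, f)` of `𝒫_L`: `e ω^l f` and `u = e`. -/
def InPL (e : Idem S) (u : S) (f : Idem S) : Prop := OmegaL e f ∧ u = e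

/-- `r(e, u, f)` is a morphism of `𝒬_L`: `u ∈ E(L_f) ∩ ω(e)`. -/
def InQL (e : Idem S) (u : S) (f : Idem S) : Prop :=
  ∃ g : Idem S, u = g ∧ GreenL g f ∧ Omega g e

/-- `r(e, u, f)` is a morphism of `𝒢_L`: there is a morphism `(u, u')` from `e` to `f` in the
inductive groupoid. -/
def InGL (e : Idem S) (u : S) (f : Idem S) : Prop :=
  ∃ a : (⟨e⟩ : IndGroupoid S) ⟶ ⟨f⟩, GHom.x a = u

/-- The morphisms `r(e, u, f)` from the class of `e` to the class of `f` of the quiver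
`ℒ_Q = 𝒫_L ∪ 𝒬_L ∪ 𝒢_L`. -/
structure LQEdge (a b : EModL S) where
  e : Idem S
  u : S
  f : Idem S
  dom : toEModL e = a
  cod : toEModL f = b
  mem : InPL e u f ∨ InQL e u f ∨ InGL e u f

instance : Quiver (EModL S) where
  Hom a b := LQEdge a b

/-- `LQLabel p e u f`: the morphism `p` of the free category on `ℒ_Q` is written `r(e, u, f)`,
according to the composition `r(e, u, f) r(g, v, h) = r(e, u v, h)`, where the identity at the
class of `e` is `r(e, e, e)`. -/
inductive LQLabel : {a b : EModL S} → Quiver.Path a b → Idem S → S → Idem S → Prop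
  | nil {a : EModL S} (e : Idem S) (he : toEModL e = a) :
      LQLabel (Quiver.Path.nil : Quiver.Path a a) e e e
  | cons {a b c : EModL S} {p : Quiver.Path a b} {e : Idem S} {u : S} {f : Idem S}
      (h : LQLabel p e u f) (r : LQEdge b c) : LQLabel (Quiver.Path.cons p r) e (u * r.u) r.f

variable (S) in
/-- The relation `∼` on the free category: `r(e, u, f) ∼ r(g, v, h)` if and only if `e ℒ g`,
`f ℒ h` and `u = e v`. -/
def LQRel : HomRel (Paths (EModL S)) := fun _ _ p q =>
  ∃ (e : Idem S) (u : S) (f g : Idem S) (v : S) (h : Idem S),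
    LQLabel p e u f ∧ LQLabel q g v h ∧ GreenL e g ∧ GreenL f h ∧ u = e * v

variable (S) in
/-- The category `ℒ_G`: the quotient by `∼` of the free category on the quiver `ℒ_Q`. -/
abbrev LG : Type u := CategoryTheory.Quotient (LQRel S)

/-- The object of `ℒ_G` given by `e`. -/
def LG.of (e : Idem S) : LG S := ⟨toEModL e⟩

/-- The class in `ℒ_G` of a path in the quiver `ℒ_Q`. -/
def LG.ofPath {a b : LG S} (p : Quiver.Path (V := EModL S) a.as b.as) : a ⟶ b :=
  (CategoryTheory.Quotient.functor (LQRel S)).map (X := a.as) (Y := b.as) p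

/-- The inclusions of `ℒ_G` are the (classes of) morphisms of `𝒫_L`. -/
instance : Inclusions (LG S) where
  incl {a b} m := ∃ r : LQEdge a.as b.as, InPL r.e r.u r.f ∧
    m = LG.ofPath (Quiver.Path.nil.cons r)

variable (S) in
/-- The category `ℛ_G`, obtained by the dual construction, that is, from the opposite semigroup.
The morphism `l(e, u, f)`, `u ∈ f S e`, is the morphism `r(e, u, f)` of the opposite semigroup;
a morphism `(x, x')` from `e` to `f` in the inductive groupoid of `S` is a morphism `(x', x)` from
`e` to `f` in the one of the opposite semigroup and gives the morphism `l(e, x', f)`. -/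
abbrev RG : Type u := LG Sᵐᵒᵖ

theorem LQEdge.between {a b : EModL S} (r : LQEdge a b) : Between r.e r.u r.f := by
  obtain ⟨e, u, f, _, _, h⟩ := r
  rw [between_iff]
  rcases h with ⟨h, rfl⟩ | ⟨g, rfl, h, h'⟩ | ⟨a, rfl⟩
  · exact ⟨e.2, h⟩
  · exact ⟨h'.2, h.1⟩
  · refine ⟨?_, ?_⟩
    · exact (congrArg (· * GHom.x a) (GHom.dom a)).symm.trans (GHom.mul_mul a)
    · exact (congrArg (GHom.x a * ·) (GHom.cod a)).symm.trans
        ((mul_assoc _ _ _).symm.trans (GHom.mul_mul a))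

theorem LQLabel.spec {a b : EModL S} {p : Quiver.Path a b} {e : Idem S} {u : S} {f : Idem S}
    (h : LQLabel p e u f) : toEModL e = a ∧ toEModL f = b ∧ Between e u f := by
  induction h with
  | nil e he => exact ⟨he, he, e, by rw [e.2, e.2]⟩
  | cons h r ih =>
    refine ⟨ih.1, r.cod, between_iff.2 ⟨?_, ?_⟩⟩
    · rw [← mul_assoc, (between_iff.1 ih.2.2).1]
    · rw [mul_assoc, (between_iff.1 r.between).2]

theorem LQLabel.exists {a b : EModL S} (p : Quiver.Path a b) :
    ∃ (e : Idem S) (u : S) (f : Idem S), LQLabel p e u f := by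
  induction p with
  | nil =>
    obtain ⟨e, he⟩ := Quotient.exists_rep a
    exact ⟨e, e, e, LQLabel.nil e he⟩
  | cons p r ih =>
    obtain ⟨e, u, f, h⟩ := ih
    exact ⟨e, _, _, LQLabel.cons h r⟩

/-! ### The functor `𝔏` -/

/-- The object map `e ↦ S e` from `E/ℒ` to the principal left ideals. -/
def objL (a : EModL S) : LS S :=
  Quotient.lift LS.of (fun _ _ h => by
    have : ∀ {x y : LS S}, x.carrier = y.carrier → x = y := by
      rintro ⟨x, _⟩ ⟨y, _⟩ rfl
      rfl
    exact this (leftIdeal_eq.2 h)) a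

variable (S) in
/-- The functor on the free category with `r(e, u, f) ↦ ρ(e, u, f)` on the morphisms of `ℒ_Q`. -/
def preL : Paths (EModL S) ⥤ LS S :=
  Paths.lift
    { obj := objL
      map := fun {_ _} r => LS.rho (LQEdge.e r) (LQEdge.u r) (LQEdge.f r)
        (congrArg objL (LQEdge.dom r)) (congrArg objL (LQEdge.cod r)) (LQEdge.between r) }

theorem preL_map_apply {a b : EModL S} {p : Quiver.Path a b} {e : Idem S} {u : S} {f : Idem S}
    (h : LQLabel p e u f) (x : (objL a).carrier) :
    (LS.Hom.toFun ((preL S).map (X := a) (Y := b) p) x : S) = x * u := by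
  induction h with
  | nil e he =>
    subst he
    exact (mem_leftIdeal.1 x.2).symm
  | cons h r ih =>
    rw [← mul_assoc, ← ih]
    rfl

variable (S) in
/-- The functor `𝔏 : ℒ_G ⥤ ℒ_S` with `𝔏(e) = S e` and `𝔏(r(e, u, f)) = ρ(e, u, f)`. -/
def functorL : LG S ⥤ LS S :=
  CategoryTheory.Quotient.lift (LQRel S) (preL S) (by
    rintro a b p q ⟨e, u, f, g, v, h, hp, hq, heg, hfh, huv⟩
    refine LS.hom_ext fun x => ?_
    refine (preL_map_apply hp x).trans (Eq.trans ?_ (preL_map_apply hq x).symm)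
    have hx : (x : S) * e = x := by
      obtain ⟨rfl, _⟩ := hp.spec
      exact mem_leftIdeal.1 x.2
    rw [huv, ← mul_assoc, hx])

variable (S) in
/-- The functor `ℜ : ℛ_G ⥤ ℛ_S` with `ℜ(e) = e S` and `ℜ(l(e, u, f)) = λ(e, u, f)`. -/
abbrev functorR : RG S ⥤ RS S := functorL Sᵐᵒᵖ

end

/-! ### Morphisms as triples

Both `ℒ_S` and `ℒ_G` have objects given by the idempotents `e` up to `ℒ`, and morphisms given by
triples `(e, u, f)` with `u ∈ e S f`. The principal cones and the functors `Γ` and `Δ` are built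
in the same way from such a description of the morphisms. -/

/-- A description of the objects and morphisms of `C` by the idempotents of `S` and by triples
`(e, u, f)` with `u ∈ e S f`. -/
class TripleModel (S : Type u) [Semigroup S] (C : Type u) [Category.{u} C] [Inclusions C] where
  of : Idem S → C
  mor : ∀ {c d : C} (e : Idem S) (u : S) (f : Idem S), of e = c → of f = d → Between e u f →
    (c ⟶ d)
  of_surjective : Function.Surjective of
  of_eq_iff : ∀ {e f : Idem S}, of e = of f ↔ GreenL e f
  mor_surjective : ∀ {c d : C} (e f : Idem S) (he : of e = c) (hf : of f = d) (m : c ⟶ d),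
    ∃ (u : S) (hu : Between e u f), m = mor e u f he hf hu
  mor_eq_iff : ∀ {c d : C} {e f g h : Idem S} {u v : S} (he : of e = c) (hf : of f = d)
    (hu : Between e u f) (hg : of g = c) (hh : of h = d) (hv : Between g v h),
    mor e u f he hf hu = mor g v h hg hh hv ↔ u = e * v
  mor_id : ∀ {c : C} (e : Idem S) (he : of e = c) (h : Between e (e : S) e),
    mor e e e he he h = 𝟙 c
  mor_comp : ∀ {c d d' : C} {e f g h : Idem S} {u v : S} (he : of e = c) (hf : of f = d)
    (hu : Between e u f) (hg : of g = d) (hh : of h = d') (hv : Between g v h)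
    (huv : Between e (u * v) h),
    mor e u f he hf hu ≫ mor g v h hg hh hv = mor e (u * v) h he hh huv
  incl_iff : ∀ {c d : C} (m : c ⟶ d), incl m ↔
    ∃ (e f : Idem S) (he : of e = c) (hf : of f = d) (h : Between e (e : S) f),
      m = mor e e f he hf h

theorem LS.ext_carrier {S : Type u} [Semigroup S] {A B : LS S} (h : A.carrier = B.carrier) :
    A = B := by
  obtain ⟨A, _⟩ := A
  obtain ⟨B, _⟩ := B
  obtain rfl : A = B := h
  rfl

theorem LS.mul_eq {S : Type u} [Semigroup S] {A : LS S} {e : Idem S} (he : LS.of e = A)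
    (x : A.carrier) : (x : S) * e = x := by
  subst he
  exact mem_leftIdeal.1 x.2

theorem LS.idem_mem {S : Type u} [Semigroup S] {A : LS S} {e : Idem S} (he : LS.of e = A) :
    (e : S) ∈ A.carrier := by
  subst he
  exact mem_leftIdeal.2 e.2

/-- In `ℒ_S` the triple `(e, u, f)` gives the morphism `ρ(e, u, f)`. -/
instance (S : Type u) [Semigroup S] : TripleModel S (LS S) where
  of := LS.of
  mor := LS.rho
  of_surjective A := by
    obtain ⟨e, he⟩ := A.exists_idem
    exact ⟨e, LS.ext_carrier he⟩
  of_eq_iff {e f} := by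
    rw [← leftIdeal_eq]
    exact ⟨fun h => congrArg LS.carrier h, fun h => LS.ext_carrier h⟩
  mor_surjective {A B} e f he hf m := by
    obtain ⟨g, v, h, hg, hh, hv, hm⟩ := LS.Hom.exists_eq m
    refine ⟨e * v, between_iff.2 ⟨by rw [← mul_assoc, e.2], ?_⟩, LS.hom_ext fun x => ?_⟩
    · rw [mul_assoc]
      have : v * f = v := by
        have h1 := (between_iff.1 hv).2
        have h2 := LS.mul_eq hf ⟨h, LS.idem_mem (LS.ext_carrier hh : LS.of h = B)⟩
        dsimp only at h2
        rw [← h1, mul_assoc, h2]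
      rw [this]
    · rw [hm]
      change _ = (x : S) * (e * v)
      rw [← mul_assoc, LS.mul_eq he]
  mor_eq_iff {A B e f g h u v} he hf hu hg hh hv := by
    constructor
    · intro H
      have : (e : S) * u = e * v :=
        congrArg (fun m : A ⟶ B => (LS.Hom.toFun m ⟨e, LS.idem_mem he⟩ : S)) H
      rw [← this, (between_iff.1 hu).1]
    · rintro rfl
      refine LS.hom_ext fun x => ?_
      change (x : S) * (e * v) = x * v
      rw [← mul_assoc, LS.mul_eq he]
  mor_id e he h := LS.hom_ext fun x => LS.mul_eq he x
  mor_comp he hf hu hg hh hv huv := LS.hom_ext fun x => mul_assoc _ _ _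
  incl_iff {A B} m := by
    constructor
    · intro H
      obtain ⟨e, he⟩ := A.exists_idem
      obtain ⟨f, hf⟩ := B.exists_idem
      have he' : LS.of e = A := LS.ext_carrier he
      have hf' : LS.of f = B := LS.ext_carrier hf
      have hef : (e : S) * f = e := by
        have h1 := H ⟨e, LS.idem_mem he'⟩
        have h2 := LS.mul_eq hf' (LS.Hom.toFun m ⟨e, LS.idem_mem he'⟩)
        rw [h1] at h2
        exact h2
      refine ⟨e, f, he', hf', between_iff.2 ⟨e.2, hef⟩, LS.hom_ext fun x => ?_⟩
      rw [H x]
      exact (LS.mul_eq he' x).symm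
    · rintro ⟨e, f, he, hf, h, rfl⟩ x
      exact LS.mul_eq he x

/-- Every `u ∈ e S f` gives a morphism `r(e, u, f) = r(e, g, g) r(g, u, h) r(h, h, f)` of the
free category on `ℒ_Q`. -/
theorem exists_path {S : Type u} [Semigroup S] [IsRegularSemigroup S] {a b : EModL S}
    (e : Idem S) (u : S) (f : Idem S) (he : toEModL e = a) (hf : toEModL f = b)
    (hu : Between e u f) : ∃ p : Quiver.Path a b, LQLabel p e u f := by
  obtain ⟨v, h₁, h₂⟩ := IsRegularSemigroup.exists_inverse u
  obtain ⟨heu, huf⟩ := between_iff.1 hu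
  have hg : u * v * e * (u * v * e) = u * v * e := by
    calc u * v * e * (u * v * e) = u * v * (e * u) * v * e := by simp only [mul_assoc]
      _ = u * v * e := by rw [heu, h₁]
  let g : Idem S := ⟨u * v * e, hg⟩
  have hh : v * u * (v * u) = v * u := by rw [← mul_assoc, h₂]
  let h : Idem S := ⟨v * u, hh⟩
  let r₁ : LQEdge a (toEModL g) := ⟨e, g, g, he, rfl, Or.inr (Or.inl ⟨g, rfl, ⟨g.2, g.2⟩,
    by change u * v * e * e = u * v * e; rw [mul_assoc, e.2],
    by change e * (u * v * e) = u * v * e; rw [← mul_assoc, ← mul_assoc, heu]⟩)⟩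
  let m : GHom g h := ⟨u, v * e,
    by rw [← mul_assoc, mul_assoc, heu, h₁],
    by rw [mul_assoc v, heu, ← mul_assoc, h₂],
    by change u * (v * e) = u * v * e; rw [mul_assoc],
    by change v * e * u = v * u; rw [mul_assoc, heu]⟩
  let r₂ : LQEdge (toEModL g) (toEModL h) := ⟨g, u, h, rfl, rfl, Or.inr (Or.inr ⟨m, rfl⟩)⟩
  let r₃ : LQEdge (toEModL h) b := ⟨h, h, f, rfl, hf, Or.inl
    ⟨by change v * u * f = v * u; rw [mul_assoc, huf], rfl⟩⟩
  refine ⟨((Quiver.Path.nil.cons r₁).cons r₂).cons r₃, ?_⟩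
  have H := ((LQLabel.nil e he).cons r₁).cons r₂ |>.cons r₃
  have hval : (e : S) * (u * v * e) * u * (v * u) = u := by
    calc (e : S) * (u * v * e) * u * (v * u) = (e * u) * v * (e * u) * v * u := by
          simp only [mul_assoc]
      _ = u := by rw [heu, h₁, h₁]
  exact hval ▸ H

theorem LG.as_eq {S : Type u} [Semigroup S] {a : LG S} {e : Idem S} (he : LG.of e = a) :
    toEModL e = a.as := by
  subst he
  rfl

/-- The morphism `r(e, u, f)` of `ℒ_G`, for `u ∈ e S f`. -/
noncomputable def LG.r {S : Type u} [Semigroup S] [IsRegularSemigroup S] {a b : LG S}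
    (e : Idem S) (u : S) (f : Idem S) (he : LG.of e = a) (hf : LG.of f = b)
    (hu : Between e u f) : a ⟶ b :=
  LG.ofPath (exists_path e u f (LG.as_eq he)
    (LG.as_eq hf) hu).choose

theorem LG.r_spec {S : Type u} [Semigroup S] [IsRegularSemigroup S] {a b : LG S}
    (e : Idem S) (u : S) (f : Idem S) (he : LG.of e = a) (hf : LG.of f = b)
    (hu : Between e u f) : ∃ p : Quiver.Path (V := EModL S) a.as b.as,
      LQLabel p e u f ∧ LG.r e u f he hf hu = LG.ofPath p :=
  ⟨_, (exists_path e u f (LG.as_eq he)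
    (LG.as_eq hf) hu).choose_spec, rfl⟩

/-- Two paths have the same class in `ℒ_G` exactly when they are related by `∼`. -/
theorem LG.ofPath_eq_iff {S : Type u} [Semigroup S] {a b : LG S}
    {p q : Quiver.Path (V := EModL S) a.as b.as} {e f g h : Idem S} {u v : S}
    (hp : LQLabel p e u f) (hq : LQLabel q g v h) :
    LG.ofPath p = LG.ofPath q ↔ u = e * v := by
  have hpe := hp.spec
  have hqe := hq.spec
  constructor
  · intro H
    have H' := congrArg (fun m : a ⟶ b => (functorL S).map m) H
    have hmem : (e : S) ∈ (objL a.as).carrier := by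
      rw [← hpe.1]
      exact mem_leftIdeal.2 e.2
    have h1 := preL_map_apply hp ⟨e, hmem⟩
    have h2 := preL_map_apply hq ⟨e, hmem⟩
    have h3 : (preL S).map (X := a.as) (Y := b.as) p = (preL S).map (X := a.as) (Y := b.as) q := H'
    rw [h3] at h1
    have h4 : (e : S) * u = e * v := h1.symm.trans h2
    rw [← h4, (between_iff.1 hpe.2.2).1]
  · intro H
    exact CategoryTheory.Quotient.sound (LQRel S) ⟨e, u, f, g, v, h, hp, hq,
      toEModL_eq.1 (hpe.1.trans hqe.1.symm), toEModL_eq.1 (hpe.2.1.trans hqe.2.1.symm), H⟩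

theorem LQLabel.comp {S : Type u} [Semigroup S] {a b c : EModL S} {p : Quiver.Path a b}
    {q : Quiver.Path b c} {e f g h : Idem S} {u v : S} (hp : LQLabel p e u f)
    (hq : LQLabel q g v h) : ∃ h' : Idem S, LQLabel (p.comp q) e (u * v) h' := by
  induction hq with
  | nil g hg =>
    refine ⟨f, ?_⟩
    have hfg : GreenL f g := toEModL_eq.1 (hp.spec.2.1.trans hg.symm)
    have : u * g = u := by
      rw [← (between_iff.1 hp.spec.2.2).2, mul_assoc]
      exact congrArg (u * ·) hfg.1
    rw [this]
    exact hp
  | cons hq r ih =>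
    obtain ⟨h', H⟩ := ih
    refine ⟨r.f, ?_⟩
    rw [← mul_assoc]
    exact H.cons r

/-- In `ℒ_G` the triple `(e, u, f)` gives the morphism `r(e, u, f)`. -/
noncomputable instance (S : Type u) [Semigroup S] [IsRegularSemigroup S] :
    TripleModel S (LG S) where
  of := LG.of
  mor := LG.r
  of_surjective := by
    rintro ⟨a⟩
    obtain ⟨e, he⟩ := Quotient.exists_rep a
    exact ⟨e, congrArg CategoryTheory.Quotient.mk he⟩
  of_eq_iff {e f} := by
    rw [← toEModL_eq]
    exact ⟨fun h => congrArg (fun a : LG S => (a.as : EModL S)) h,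
      fun h => congrArg CategoryTheory.Quotient.mk h⟩
  mor_surjective {a b} e f he hf m := by
    obtain ⟨p, rfl⟩ : ∃ p : Quiver.Path (V := EModL S) a.as b.as, m = LG.ofPath p := by
      obtain ⟨p, hp⟩ := (CategoryTheory.Quotient.functor (LQRel S)).map_surjective
        (X := a.as) (Y := b.as) m
      exact ⟨p, hp.symm⟩
    obtain ⟨g, v, h, hp⟩ := LQLabel.exists p
    have hs := hp.spec
    have hb : Between e (e * v) f := by
      refine between_iff.2 ⟨by rw [← mul_assoc, e.2], ?_⟩
      have hfh : GreenL h f := toEModL_eq.1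
        (hs.2.1.trans (LG.as_eq hf).symm)
      rw [mul_assoc, ← (between_iff.1 hs.2.2).2, mul_assoc]
      exact congrArg (fun x => e * (v * x)) hfh.1
    refine ⟨e * v, hb, ?_⟩
    obtain ⟨q, hq, hq'⟩ := LG.r_spec e (e * v) f he hf hb
    rw [hq']
    exact ((LG.ofPath_eq_iff hq hp).2 rfl).symm
  mor_eq_iff he hf hu hg hh hv := by
    obtain ⟨p, hp, hp'⟩ := LG.r_spec _ _ _ he hf hu
    obtain ⟨q, hq, hq'⟩ := LG.r_spec _ _ _ hg hh hv
    rw [hp', hq']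
    exact LG.ofPath_eq_iff hp hq
  mor_id {a} e he h := by
    obtain ⟨p, hp, hp'⟩ := LG.r_spec _ _ _ he he h
    rw [hp']
    have hn : LQLabel (Quiver.Path.nil : Quiver.Path (V := EModL S) a.as a.as) e e e :=
      LQLabel.nil e (LG.as_eq he)
    exact (LG.ofPath_eq_iff hp hn).2 e.2.symm
  mor_comp he hf hu hg hh hv huv := by
    obtain ⟨p, hp, hp'⟩ := LG.r_spec _ _ _ he hf hu
    obtain ⟨q, hq, hq'⟩ := LG.r_spec _ _ _ hg hh hv
    obtain ⟨w, hw, hw'⟩ := LG.r_spec _ _ _ he hh huv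
    rw [hp', hq', hw']
    obtain ⟨h', hpq⟩ := hp.comp hq
    exact (LG.ofPath_eq_iff hpq hw).2 (between_iff.1 huv).1.symm
  incl_iff {a b} m := by
    constructor
    · rintro ⟨⟨e, u, f, he, hf, hmem⟩, ⟨hef, hu⟩, rfl⟩
      obtain rfl : u = e := hu
      have hb : Between e (e : S) f := between_iff.2 ⟨e.2, hef⟩
      refine ⟨e, f, congrArg CategoryTheory.Quotient.mk he, congrArg CategoryTheory.Quotient.mk hf,
        hb, ?_⟩
      obtain ⟨p, hp, hp'⟩ := LG.r_spec (a := a) (b := b) e e f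
        (congrArg CategoryTheory.Quotient.mk he) (congrArg CategoryTheory.Quotient.mk hf) hb
      rw [hp']
      refine (LG.ofPath_eq_iff ((LQLabel.nil e he).cons _) hp).2 rfl
    · rintro ⟨e, f, he, hf, h, rfl⟩
      obtain ⟨p, hp, hp'⟩ := LG.r_spec _ _ _ he hf h
      have hef : InPL e (e : S) f := ⟨(between_iff.1 h).2, rfl⟩
      have he' := LG.as_eq he
      refine ⟨⟨e, e, f, he', LG.as_eq hf, Or.inl hef⟩, hef, ?_⟩
      rw [hp']
      refine (LG.ofPath_eq_iff hp ((LQLabel.nil e he').cons _)).2 ?_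
      change (e : S) = e * (e * e)
      rw [e.2, e.2]

/-- `𝔏(r(e, u, f)) = ρ(e, u, f)`. -/
theorem functorL_map_r {S : Type u} [Semigroup S] [IsRegularSemigroup S] (e : Idem S) (u : S)
    (f : Idem S) (h : Between e u f) :
    (functorL S).map (LG.r e u f rfl rfl h) = LS.rho e u f rfl rfl h := by
  obtain ⟨p, hp, hp'⟩ := LG.r_spec e u f rfl rfl h
  rw [hp']
  exact LS.hom_ext fun x => preL_map_apply hp x

/-! ### Principal cones and normality -/

namespace TripleModel

variable {S : Type u} [Semigroup S] {C : Type u} [Category.{u} C] [Inclusions C] [TripleModel S C]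

variable (S) in
/-- A representative in `E(S)` of an object. -/
noncomputable def rep (c : C) : Idem S := (of_surjective (S := S) c).choose

theorem of_rep (c : C) : of (rep S c) = c := (of_surjective (S := S) c).choose_spec

theorem green {c : C} {e f : Idem S} (he : of e = c) (hf : of f = c) : (e : S) * f = e :=
  (of_eq_iff.1 (he.trans hf.symm)).1

theorem between_self (e : Idem S) : Between e (e : S) e := between_iff.2 ⟨e.2, e.2⟩

theorem between_mul (g : Idem S) (e : Idem S) : Between g ((g : S) * e) e :=
  between_iff.2 ⟨by rw [← mul_assoc, g.2], by rw [mul_assoc, e.2]⟩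

theorem between_comp {e f g h : Idem S} {u v : S} (hu : Between e u f) (hv : Between g v h) :
    Between e (u * v) h :=
  between_iff.2 ⟨by rw [← mul_assoc, (between_iff.1 hu).1],
    by rw [mul_assoc, (between_iff.1 hv).2]⟩

/-- The principal cone `r^e` with apex `e` and components `r^e(g) = r(g, g e, e)`. -/
noncomputable def principalCone (e : Idem S) {c : C} (he : of e = c) : NormalCone c where
  comp a := mor (rep S a) (rep S a * e) e (of_rep a) he (between_mul _ _)
  incl_comp {a b} j hj := by
    obtain ⟨g, h, hg, hh, hb, rfl⟩ := (incl_iff (S := S) j).1 hj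
    rw [mor_comp _ _ _ _ _ _ (between_comp hb (between_mul _ _)), mor_eq_iff,
      ← mul_assoc, ← mul_assoc, green hg (of_rep a)]
    have : (g : S) * rep S b = g := by
      rw [← (between_iff.1 hb).2, mul_assoc, green hh (of_rep b)]
    rw [this]
  exists_iso := by
    refine ⟨c, ?_⟩
    have : mor (rep S c) (rep S c * e : S) e (of_rep c) he (between_mul _ _) = 𝟙 c := by
      rw [← mor_id e he (between_self e)]
      exact (mor_eq_iff _ _ _ _ _ _).2 rfl
    rw [this]
    infer_instance

theorem principalCone_comp (e : Idem S) {c : C} (he : of e = c) {a : C} (g : Idem S)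
    (hg : of g = a) : (principalCone e he).comp a = mor g (g * e) e hg he (between_mul _ _) := by
  refine (mor_eq_iff _ _ _ _ _ _).2 ?_
  rw [← mul_assoc, green (of_rep a) hg]

theorem categoryWithSubobjects (S : Type u) [Semigroup S] (C : Type u) [Category.{u} C]
    [Inclusions C] [TripleModel S C] : CategoryWithSubobjects C where
  incl_id a := by
    refine (incl_iff (S := S) _).2 ⟨rep S a, rep S a, of_rep a, of_rep a, between_self _, ?_⟩
    exact (mor_id _ _ _).symm
  incl_comp f g Hf Hg := by
    obtain ⟨e, f, he, hf, h, rfl⟩ := (incl_iff (S := S) _).1 Hf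
    obtain ⟨e', f', he', hf', h', rfl⟩ := (incl_iff (S := S) _).1 Hg
    have H := between_comp h h'
    have : (e : S) * e' = e := by rw [← (between_iff.1 h).2, mul_assoc, green hf he']
    refine (incl_iff (S := S) _).2 ⟨e, f', he, hf', by rwa [this] at H, ?_⟩
    rw [mor_comp _ _ _ _ _ _ H, mor_eq_iff, e.2, this]
  incl_unique f g Hf Hg := by
    obtain ⟨e, f, he, hf, h, rfl⟩ := (incl_iff (S := S) _).1 Hf
    obtain ⟨e', f', he', hf', h', rfl⟩ := (incl_iff (S := S) _).1 Hg
    exact (mor_eq_iff _ _ _ _ _ _).2 (green he he').symm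
  incl_antisymm {a b} f g Hf Hg := by
    obtain ⟨e, f, he, hf, h, rfl⟩ := (incl_iff (S := S) _).1 Hf
    obtain ⟨f', e', hf', he', h', rfl⟩ := (incl_iff (S := S) _).1 Hg
    rw [← he, ← hf]
    refine of_eq_iff.2 ⟨(between_iff.1 h).2, ?_⟩
    change (f : S) * e = f
    have h1 : (f : S) * e' = f := by
      rw [← green hf hf', mul_assoc, (between_iff.1 h').2]
    rw [← h1, mul_assoc, green he' he]
  incl_mono {a b} f Hf := by
    obtain ⟨e, f, he, hf, h, rfl⟩ := (incl_iff (S := S) _).1 Hf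
    refine ⟨fun {z} x y hxy => ?_⟩
    obtain ⟨u, hu, rfl⟩ := mor_surjective (rep S z) e (of_rep z) he x
    obtain ⟨v, hv, rfl⟩ := mor_surjective (rep S z) e (of_rep z) he y
    rw [mor_comp _ _ _ _ _ _ (between_comp hu h),
      mor_comp _ _ _ _ _ _ (between_comp hv h), mor_eq_iff] at hxy
    rw [mor_eq_iff, ← (between_iff.1 hu).2, hxy, (between_iff.1 hv).2]
  incl_of_comp {a b c} k g Hg hkg := by
    obtain ⟨f, f', hf, hf', h, rfl⟩ := (incl_iff (S := S) _).1 Hg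
    obtain ⟨e, e', he, he', h', heq⟩ := (incl_iff (S := S) _).1 hkg
    obtain ⟨u, hu, rfl⟩ := mor_surjective e f he hf k
    rw [mor_comp _ _ _ _ _ _ (between_comp hu h), mor_eq_iff, e.2,
      (between_iff.1 hu).2] at heq
    subst heq
    exact (incl_iff (S := S) _).2 ⟨e, f, he, hf, hu, rfl⟩

theorem normalCategory (S : Type u) [Semigroup S] [IsRegularSemigroup S] (C : Type u) [Category.{u} C]
    [Inclusions C] [TripleModel S C] : NormalCategory C where
  toCategoryWithSubobjects := categoryWithSubobjects S C
  normal_factorization {c d} m := by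
    obtain ⟨u, hu, rfl⟩ := mor_surjective (rep S c) (rep S d) (of_rep c) (of_rep d) m
    generalize_proofs hc hd at *
    generalize rep S c = e at *
    generalize rep S d = f at *
    obtain ⟨v, h₁, h₂⟩ := IsRegularSemigroup.exists_inverse u
    obtain ⟨heu, huf⟩ := between_iff.1 hu
    have hg : u * v * e * (u * v * e) = u * v * e := by
      calc u * v * e * (u * v * e) = u * v * (e * u) * v * e := by simp only [mul_assoc]
        _ = u * v * e := by rw [heu, h₁]
    let g : Idem S := ⟨u * v * e, hg⟩
    have hh : v * u * (v * u) = v * u := by rw [← mul_assoc, h₂]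
    let h : Idem S := ⟨v * u, hh⟩
    have heg : (e : S) * g = g := by
      change (e : S) * (u * v * e) = u * v * e
      rw [← mul_assoc, ← mul_assoc, heu]
    have hge : (g : S) * e = g := by
      change u * v * e * e = u * v * e
      rw [mul_assoc, e.2]
    have hgu : (g : S) * u = u := by
      change u * v * e * u = u
      rw [mul_assoc, heu, h₁]
    have huh : u * (h : S) = u := by
      change u * (v * u) = u
      rw [← mul_assoc, h₁]
    have hhf : (h : S) * f = h := by
      change v * u * f = v * u
      rw [mul_assoc, huf]
    have bq : Between e (g : S) g := between_iff.2 ⟨heg, g.2⟩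
    have bi : Between g (g : S) e := between_iff.2 ⟨g.2, hge⟩
    have bu : Between g u h := between_iff.2 ⟨hgu, huh⟩
    have bj : Between h (h : S) f := between_iff.2 ⟨h.2, hhf⟩
    have bv : Between h (v * e) g := by
      refine between_iff.2 ⟨?_, ?_⟩
      · change v * u * (v * e) = v * e
        rw [← mul_assoc, h₂]
      · change v * e * (u * v * e) = v * e
        calc v * e * (u * v * e) = v * (e * u) * v * e := by simp only [mul_assoc]
          _ = v * e := by rw [heu, h₂]
    refine ⟨{
      q := mor e (g : S) g hc rfl bq
      u := mor g u h rfl rfl bu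
      j := mor h (h : S) f rfl hd bj
      retraction := ⟨mor g (g : S) e rfl hc bi,
        (incl_iff (S := S) _).2 ⟨g, e, rfl, hc, bi, rfl⟩, ?_⟩
      iso := ⟨mor h (v * e) g rfl rfl bv, ?_, ?_⟩
      inclusion := (incl_iff (S := S) _).2 ⟨h, f, rfl, hd, bj, rfl⟩
      fac := ?_ }⟩
    · rw [mor_comp _ _ _ _ _ _ (between_comp bi bq), ← mor_id g rfl (between_self g),
        mor_eq_iff]
    · rw [mor_comp _ _ _ _ _ _ (between_comp bu bv), ← mor_id g rfl (between_self g),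
        mor_eq_iff, g.2]
      exact (mul_assoc u v e).symm
    · rw [mor_comp _ _ _ _ _ _ (between_comp bv bu), ← mor_id h rfl (between_self h),
        mor_eq_iff, h.2]
      change v * e * u = v * u
      rw [mul_assoc, heu]
    · rw [mor_comp _ _ _ _ _ _ (between_comp bu bj),
        mor_comp _ _ _ _ _ _ (between_comp bq (between_comp bu bj)), mor_eq_iff,
        huh, hgu, heu]
  incl_splits {c d} j hj := by
    obtain ⟨e, f, he, hf, h, rfl⟩ := (incl_iff (S := S) _).1 hj
    refine ⟨mor f (f * e) e hf he (between_mul _ _), ?_⟩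
    rw [mor_comp _ _ _ _ _ _ (between_comp h (between_mul _ _)),
      ← mor_id e he (between_self e), mor_eq_iff, ← mul_assoc, (between_iff.1 h).2]
  exists_cone c := by
    refine ⟨principalCone (rep S c) (of_rep c), ?_⟩
    rw [principalCone_comp _ _ (rep S c) (of_rep c), ← mor_id (rep S c) (of_rep c) (between_self _)]
    exact (mor_eq_iff _ _ _ _ _ _).2 rfl

end TripleModel

/-- `ℒ_S` (and, applied to the opposite semigroup, `ℛ_S`) is a normal category. -/
instance (S : Type u) [Semigroup S] [IsRegularSemigroup S] : NormalCategory (LS S) :=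
  TripleModel.normalCategory S (LS S)

/-- `ℒ_G` (and, applied to the opposite semigroup, `ℛ_G`) is a normal category. -/
instance (S : Type u) [Semigroup S] [IsRegularSemigroup S] : NormalCategory (LG S) :=
  TripleModel.normalCategory S (LG S)

/-! ### The cross-connections of `S` and of the inductive groupoid -/

namespace TripleModel

section

variable {S T : Type u} [Semigroup S] [Semigroup T] (φ : T ≃* Sᵐᵒᵖ)

/-- The idempotent of `S` corresponding to an idempotent of an anti-isomorphic semigroup `T`. -/
def antiIdem (e : Idem T) : Idem S :=
  ⟨(φ e).unop, by rw [← MulOpposite.unop_mul, ← map_mul, e.2]⟩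

theorem between_anti {e f : Idem T} {u : T} (h : Between e u f) :
    Between (antiIdem φ f) (φ u).unop (antiIdem φ e) := by
  obtain ⟨h₁, h₂⟩ := between_iff.1 h
  refine between_iff.2 ⟨?_, ?_⟩
  · change (φ f).unop * (φ u).unop = (φ u).unop
    rw [← MulOpposite.unop_mul, ← map_mul, h₂]
  · change (φ u).unop * (φ e).unop = (φ u).unop
    rw [← MulOpposite.unop_mul, ← map_mul, h₁]

variable (C : Type u) [Category.{u} C] [Inclusions C] [NormalCategory C] [TripleModel S C]

/-- The H-functor `H(r^e; -)` of the principal cone `r^e`. -/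
noncomputable abbrev gammaObj (e : Idem T) : NormalDual C :=
  NormalDual.of (principalCone (C := C) (antiIdem φ e) rfl)

/-- The natural transformation `η_{r^e} C(r(f, u, e), -) η_{r^f}⁻¹` from `H(r^e; -)` to
`H(r^f; -)`. -/
noncomputable def gammaMap (e : Idem T) (u : T) (f : Idem T) (h : Between e u f) :
    gammaObj φ C e ⟶ gammaObj φ C f :=
  ⟨(eta (principalCone (C := C) (antiIdem φ e) rfl)).hom ≫
    coyoneda.map (mor (antiIdem φ f) (φ u).unop (antiIdem φ e) rfl rfl (between_anti φ h)).op ≫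
    (eta (principalCone (C := C) (antiIdem φ f) rfl)).inv⟩

theorem gammaMap_id (e : Idem T) (h : Between e (e : T) e) :
    gammaMap φ C e e e h = 𝟙 _ := by
  refine NormalDual.Hom.ext ?_
  have : mor (antiIdem φ e) (φ e).unop (antiIdem φ e) rfl rfl (between_anti φ h) =
      𝟙 (of (antiIdem φ e) : C) := mor_id _ _ _
  simp only [gammaMap]
  rw [this, op_id, CategoryTheory.Functor.map_id, Category.id_comp, Iso.hom_inv_id]
  rfl

theorem gammaMap_comp {e f h : Idem T} {u v : T}
    (hu : Between e u f) (hv : Between f v h) (huv : Between e (u * v) h) :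
    gammaMap φ C e u f hu ≫ gammaMap φ C f v h hv = gammaMap φ C e (u * v) h huv := by
  refine NormalDual.Hom.ext ?_
  have := mor_comp (C := C) rfl rfl (between_anti φ hv) rfl rfl (between_anti φ hu)
    (by simpa using between_anti φ huv)
  change (gammaMap φ C e u f hu).nat ≫ (gammaMap φ C f v h hv).nat = _
  simp only [gammaMap, Category.assoc, Iso.inv_hom_id_assoc, ← Functor.map_comp_assoc, ← op_comp]
  rw [this]
  simp only [map_mul, MulOpposite.unop_mul]

theorem gammaMap_congr {D : Type u} [Category.{u} D] [Inclusions D] [TripleModel T D] {d d' : D}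
    {e f : Idem T} {u v : T} (he : of e = d) (hf : of f = d') (hu : Between e u f)
    (hv : Between e v f) (h : mor e u f he hf hu = mor e v f he hf hv) :
    gammaMap φ C e u f hu = gammaMap φ C e v f hv := by
  rw [mor_eq_iff, (between_iff.1 hv).1] at h
  subst h
  rfl

/-- The functor `D ⥤ N*C` given on objects by `e ↦ H(r^e; -)` and on morphisms by
`(e, u, f) ↦ η_{r^e} C(r(f, u, e), -) η_{r^f}⁻¹`. It does not depend on the representatives
used here, see `gamma_obj` and `gamma_map`. -/
noncomputable def gamma (D : Type u) [Category.{u} D] [Inclusions D] [TripleModel T D] :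
    D ⥤ NormalDual C where
  obj d := gammaObj φ C (rep T d)
  map {d d'} l :=
    gammaMap φ C (rep T d) _ (rep T d')
      (mor_surjective (rep T d) (rep T d') (of_rep d) (of_rep d') l).choose_spec.choose
  map_id d := by
    rw [← gammaMap_id φ C (rep T d) (between_self _)]
    refine gammaMap_congr φ C (of_rep d) (of_rep d) _ _ ?_
    rw [mor_id]
    exact (mor_surjective (rep T d) (rep T d) (of_rep d) (of_rep d)
      (𝟙 d)).choose_spec.choose_spec.symm
  map_comp {a b c} l m := by
    rw [gammaMap_comp φ C _ _ (between_comp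
      (mor_surjective (rep T a) (rep T b) (of_rep a) (of_rep b) l).choose_spec.choose
      (mor_surjective (rep T b) (rep T c) (of_rep b) (of_rep c) m).choose_spec.choose)]
    refine gammaMap_congr φ C (of_rep a) (of_rep c) _ _ ?_
    rw [← mor_comp (of_rep a) (of_rep b)
      (mor_surjective (rep T a) (rep T b) (of_rep a) (of_rep b) l).choose_spec.choose
      (of_rep b) (of_rep c)
      (mor_surjective (rep T b) (rep T c) (of_rep b) (of_rep c) m).choose_spec.choose,
      ← (mor_surjective (rep T a) (rep T b) (of_rep a) (of_rep b) l).choose_spec.choose_spec,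
      ← (mor_surjective (rep T b) (rep T c) (of_rep b) (of_rep c) m).choose_spec.choose_spec]
    exact (mor_surjective (rep T a) (rep T c) (of_rep a) (of_rep c)
      (l ≫ m)).choose_spec.choose_spec.symm

theorem gammaObj_eq {e f : Idem T} (h : GreenL e f) : gammaObj φ C e = gammaObj φ C f := by
  obtain ⟨h₁, h₂⟩ := h
  have h₁' : (antiIdem φ f : S) * antiIdem φ e = antiIdem φ e := by
    change (φ f).unop * (φ e).unop = (φ e).unop
    rw [← MulOpposite.unop_mul, ← map_mul]
    exact congrArg (fun x => (φ x).unop) h₁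
  have h₂' : (antiIdem φ e : S) * antiIdem φ f = antiIdem φ f := by
    change (φ e).unop * (φ f).unop = (φ f).unop
    rw [← MulOpposite.unop_mul, ← map_mul]
    exact congrArg (fun x => (φ x).unop) h₂
  refine NormalDual.ext (H_eq_of _ _ (mor _ _ _ rfl rfl (between_mul _ _))
    (mor _ _ _ rfl rfl (between_mul _ _)) (fun x => ?_) (fun x => ?_))
  · rw [principalCone_comp _ _ _ (of_rep x), principalCone_comp _ _ _ (of_rep x),
      mor_comp _ _ _ _ _ _ (between_comp (between_mul _ _) (between_mul _ _)), mor_eq_iff, h₂',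
      mul_assoc, h₂', ← mul_assoc, (rep S x).2]
  · rw [principalCone_comp _ _ _ (of_rep x), principalCone_comp _ _ _ (of_rep x),
      mor_comp _ _ _ _ _ _ (between_comp (between_mul _ _) (between_mul _ _)), mor_eq_iff, h₁',
      mul_assoc, h₁', ← mul_assoc, (rep S x).2]

theorem gamma_obj {D : Type u} [Category.{u} D] [Inclusions D] [TripleModel T D] (e : Idem T) :
    (gamma φ C D).obj (of e) = gammaObj φ C e :=
  gammaObj_eq φ C (of_eq_iff.1 (of_rep (of e : D)))

theorem NormalDual.eq_eqToHom {F G : NormalDual C} (h : F = G) (m : F ⟶ G) (hm : incl m) :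
    m = eqToHom h := by
  subst h
  refine NormalDual.Hom.ext ?_
  ext c x
  exact Subtype.ext (hm c x)

/-- `η_{r^e} C(r(f, u, e), -) η_{r^f}⁻¹` maps `r^e * k°` to `r^f * (r(f, u, e) k)°`. -/
theorem gammaMap_apply (e : Idem T) (u : T) (f : Idem T) (h : Between e u f) {c : C}
    (k : of (antiIdem φ e) ⟶ c)
    (hx : (⟨_, star (principalCone (antiIdem φ e) rfl) k⟩ : TC C) ∈ (gammaObj φ C e).fn.obj c) :
    (NormalDual.apply (gammaMap φ C e u f h) c ⟨_, hx⟩ : TC C) =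
      ⟨_, star (principalCone (antiIdem φ f) rfl)
        (mor (antiIdem φ f) (φ u).unop (antiIdem φ e) rfl rfl (between_anti φ h) ≫ k)⟩ := by
  have hk : (⟨_, hx⟩ : Hset (principalCone (C := C) (antiIdem φ e) rfl) c) = Hequiv _ c k := rfl
  change ((Hequiv _ c (mor (antiIdem φ f) (φ u).unop (antiIdem φ e) rfl rfl (between_anti φ h) ≫
    (Hequiv _ c).symm ⟨_, hx⟩) : Hset (principalCone (C := C) (antiIdem φ f) rfl) c) : TC C) = _
  rw [hk, Equiv.symm_apply_apply]
  rfl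

theorem gammaMap_eq_eqToHom {e f : Idem T} (h : GreenL e f) (hb : Between e (e : T) f) :
    gammaMap φ C e e f hb = eqToHom (gammaObj_eq φ C h) := by
  refine NormalDual.eq_eqToHom C _ _ ?_
  rintro c ⟨_, k, rfl⟩
  refine (gammaMap_apply φ C e e f hb k _).trans ?_
  refine cone_ext _ _ (imIncl _) (imIncl _) (imIncl_incl _) (imIncl_incl _) fun a => ?_
  have h₁ : (antiIdem φ f : S) * (φ e).unop = (φ e).unop := by
    change (φ f).unop * (φ e).unop = (φ e).unop
    rw [← MulOpposite.unop_mul, ← map_mul]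
    exact congrArg (fun x => (φ x).unop) h.1
  rw [star_comp_imIncl, star_comp_imIncl, ← Category.assoc]
  congr 1
  rw [principalCone_comp _ _ _ (of_rep a), principalCone_comp _ _ _ (of_rep a),
    mor_comp _ _ _ _ _ _ (between_comp (between_mul _ _) (between_anti φ hb)), mor_eq_iff,
    mul_assoc, h₁, ← mul_assoc, (rep S a).2]
  rfl

theorem gamma_map {D : Type u} [Category.{u} D] [Inclusions D] [TripleModel T D]
    (e : Idem T) (u : T) (f : Idem T) (h : Between e u f) :
    (gamma φ C D).map (mor e u f rfl rfl h) =
      eqToHom (gamma_obj φ C e) ≫ gammaMap φ C e u f h ≫ eqToHom (gamma_obj φ C f).symm := by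
  have he : GreenL (rep T (of e : D)) e := of_eq_iff.1 (of_rep (of e : D))
  have hf : GreenL f (rep T (of f : D)) := of_eq_iff.1 (of_rep (of f : D)).symm
  have be : Between (rep T (of e : D)) (rep T (of e : D) : T) e :=
    between_iff.2 ⟨(rep T (of e : D)).2, he.1⟩
  have bf : Between f (f : T) (rep T (of f : D)) := between_iff.2 ⟨f.2, hf.1⟩
  change gammaMap φ C (rep T (of e : D)) _ (rep T (of f : D))
      (mor_surjective (rep T (of e : D)) (rep T (of f : D)) (of_rep _) (of_rep _)
        (mor e u f rfl rfl h)).choose_spec.choose =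
    eqToHom (gammaObj_eq φ C he) ≫ gammaMap φ C e u f h ≫ eqToHom (gammaObj_eq φ C hf)
  rw [← gammaMap_eq_eqToHom φ C he be, ← gammaMap_eq_eqToHom φ C hf bf,
    gammaMap_comp φ C h bf (between_comp h bf),
    gammaMap_comp φ C be (between_comp h bf) (between_comp be (between_comp h bf))]
  refine gammaMap_congr φ C (of_rep _) (of_rep _) _ _ ?_
  have key := (mor_surjective (rep T (of e : D)) (rep T (of f : D)) (of_rep _) (of_rep _)
      (mor e u f rfl rfl h)).choose_spec.choose_spec
  refine key.symm.trans ((mor_eq_iff _ _ _ _ _ _).2 ?_)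
  rw [(between_iff.1 h).2, ← mul_assoc]
  have := (between_iff.1 h).1
  have h' := he.2
  unfold OmegaL at h'
  rw [h', this]

end

end TripleModel

section

variable (S : Type u) [Semigroup S] [IsRegularSemigroup S]

/-- The functor `Γ_S : ℛ_S ⥤ N*ℒ_S`, `Γ_S(e S) = H(ρ^e; -)`,
`Γ_S(λ(e, u, f)) = η_{ρ^e} ℒ_S(ρ(f, u, e), -) η_{ρ^f}⁻¹`. -/
noncomputable def GammaS : RS S ⥤ NormalDual (LS S) :=
  TripleModel.gamma (MulEquiv.refl Sᵐᵒᵖ) (LS S) (RS S)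

/-- The functor `Δ_S : ℒ_S ⥤ N*ℛ_S`, `Δ_S(S e) = H(λ^e; -)`,
`Δ_S(ρ(e, u, f)) = η_{λ^e} ℛ_S(λ(f, u, e), -) η_{λ^f}⁻¹`. -/
noncomputable def DeltaS : LS S ⥤ NormalDual (RS S) :=
  TripleModel.gamma (MulEquiv.opOp S) (RS S) (LS S)

/-- The functor `Γ_G : ℛ_G ⥤ N*ℒ_G`, `Γ_G(e) = H(r^e; -)`,
`Γ_G(l(e, u, f)) = η_{r^e} ℒ_G(r(f, u, e), -) η_{r^f}⁻¹`. -/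
noncomputable def GammaG : RG S ⥤ NormalDual (LG S) :=
  TripleModel.gamma (MulEquiv.refl Sᵐᵒᵖ) (LG S) (RG S)

/-- The functor `Δ_G : ℒ_G ⥤ N*ℛ_G`, `Δ_G(e) = H(l^e; -)`,
`Δ_G(r(e, u, f)) = η_{l^e} ℛ_G(l(f, u, e), -) η_{l^f}⁻¹`. -/
noncomputable def DeltaG : LG S ⥤ NormalDual (RG S) :=
  TripleModel.gamma (MulEquiv.opOp S) (RG S) (LG S)

end

end CrossConn

/-!
A morphism of `ℒ_G` and of `ℒ_S` is a triple `(e, u, f)` with `u ∈ e S f`, modulo the same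
relation in both cases, and the principal cones, `Γ` and `Δ` are written in terms of triples alone.
Hence the assertions on `Γ` and `Δ` need to be proved only once, for an arbitrary `TripleModel`, and
a functor which preserves triples is an isomorphism respecting all of the structure.

By the Yoneda lemma the morphisms `H(γ; -) ⟶ H(σ; -)` are the morphisms from the apex of `σ` to that
of `γ`, and the inclusions among them are those through which `γ` factors as a cone over `σ`. For
principal cones this turns the axioms into computations in `S`: the component of `r^f` at `c` is
invertible if and only if `c` is represented by some `e ℛ f`; a cone which factors through `r^h` has
the H-functor of `r^e` for some `e ω^r h`; and two triples are transposes of each other if and only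
if they have the same middle entry.
-/

namespace CrossConn

open Inclusions (incl)

/-! ### Inclusions and isomorphisms -/

theorem incl_eqToHom_comp_comp_eqToHom_iff {C : Type u} [Category.{v} C] [Inclusions C]
    {c c' d d' : C} (hc : c' = c) (hd : d = d') (j : c ⟶ d) :
    incl (eqToHom hc ≫ j ≫ eqToHom hd) ↔ incl j := by
  subst hc hd
  simp only [eqToHom_refl, Category.comp_id, Category.id_comp]

theorem isNormalCategoryIso_of_inverse {C D : Type u} [Category.{u} C] [Inclusions C]
    [Category.{u} D] [Inclusions D] {F : C ⥤ D} {G : D ⥤ C} (hF : InclusionPreserving F)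
    (hG : InclusionPreserving G) (hFG : F ⋙ G = 𝟭 C) (hGF : G ⋙ F = 𝟭 D) :
    IsNormalCategoryIso F := by
  let equiv : C ≌ D := CategoryTheory.Equivalence.mk F G (eqToIso hFG.symm) (eqToIso hGF)
  exact
    { obj_bijective := Function.bijective_iff_has_inverse.2
        ⟨G.obj, Functor.congr_obj hFG, Functor.congr_obj hGF⟩
      full := inferInstanceAs equiv.functor.Full
      faithful := inferInstanceAs equiv.functor.Faithful
      incl_iff := fun j => by
        refine ⟨fun hj => ?_, hF j⟩
        have hGFj : incl ((F ⋙ G).map j) := hG _ hj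
        rw [Functor.congr_hom hFG j] at hGFj
        exact (incl_eqToHom_comp_comp_eqToHom_iff _ _ j).1 hGFj }

/-! ### Cones and morphisms of H-functors -/

/-- The cone `γ` is the cone `σ` followed by a morphism of the apices; equivalently, `H(γ; -)` is a
subfunctor of `H(σ; -)`, see `NormalDual.sub_of_of_iff`. -/
def NormalCone.FactorsThrough {C : Type u} [Category.{v} C] [Inclusions C] {a b : C}
    (γ : NormalCone a) (σ : NormalCone b) : Prop :=
  ∃ f : b ⟶ a, ∀ x, γ.comp x = σ.comp x ≫ f

theorem NormalCone.comp_comp_eq_of_eq {C : Type u} [Category.{v} C] [Inclusions C]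
    [CategoryWithSubobjects C] {a b d : C} {γ : NormalCone a} {σ : NormalCone b}
    (h : (⟨a, γ⟩ : TC C) = ⟨b, σ⟩) {i : a ⟶ d} {j : b ⟶ d} (hi : incl i) (hj : incl j) (x : C) :
    γ.comp x ≫ i = σ.comp x ≫ j := by
  cases h
  rw [CategoryWithSubobjects.incl_unique i j hi hj]

theorem NormalCone.comp_apex_of_isIdempotentElem {C : Type u} [Category.{v} C] [Inclusions C]
    [NormalCategory C] {c : C} {ε : NormalCone c} (h : IsIdempotentElem (⟨c, ε⟩ : TC C)) :
    ε.comp c = 𝟙 c := by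
  have hstar : (⟨_, star ε (ε.comp c)⟩ : TC C) = ⟨c, ε⟩ := h
  refine ε.cancel _ _ fun x => ?_
  rw [← star_comp_imIncl]
  exact comp_comp_eq_of_eq hstar (imIncl_incl _) (CategoryWithSubobjects.incl_id c) x

section NormalDual

variable {C : Type u} [Category.{u} C] [Inclusions C] [NormalCategory C] {a b : C}
  {γ : NormalCone a} {σ : NormalCone b}

namespace NormalDual

theorem nat_eqToHom {F G : NormalDual C} (h : F = G) :
    Hom.nat (eqToHom h) = eqToHom (congrArg (fun K => K.fn.toFunctor) h) := by
  subst h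
  rfl

theorem sub_of_eq {F G : NormalDual C} (h : F = G) : Sub F G := by
  subst h
  exact ⟨𝟙 F, fun _ _ => rfl⟩

variable (γ σ) in
/-- The Yoneda bijection from the morphisms between the apices of two cones to the morphisms between
their H-functors; it maps `f` to `η_γ C(f, -) η_σ⁻¹`. -/
noncomputable def homEquiv : (b ⟶ a) ≃ (of γ ⟶ of σ) where
  toFun f := ⟨(eta γ).hom ≫ coyoneda.map f.op ≫ (eta σ).inv⟩
  invFun m := (coyoneda.preimage ((eta γ).inv ≫ m.nat ≫ (eta σ).hom)).unop
  left_inv f := by simp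
  right_inv m := NormalDual.Hom.ext (by simp)

theorem apply_homEquiv (f : b ⟶ a) {c : C} (k : a ⟶ c) :
    (apply (homEquiv γ σ f) c (Hequiv γ c k) : TC C) = ⟨_, star σ (f ≫ k)⟩ := by
  change (Hequiv σ c (f ≫ (Hequiv γ c).symm (Hequiv γ c k)) : TC C) = _
  rw [Equiv.symm_apply_apply]
  rfl

theorem incl_homEquiv_iff {f : b ⟶ a} :
    incl (homEquiv γ σ f) ↔ ∀ x, γ.comp x = σ.comp x ≫ f := by
  constructor
  · intro hf x
    have hstar : (⟨_, star σ (f ≫ 𝟙 a)⟩ : TC C) = ⟨_, star γ (𝟙 a)⟩ :=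
      (apply_homEquiv f (𝟙 a)).symm.trans (hf a (Hequiv γ a (𝟙 a)))
    have hcomp := NormalCone.comp_comp_eq_of_eq hstar (imIncl_incl _) (imIncl_incl _) x
    simpa only [star_comp_imIncl, Category.comp_id] using hcomp.symm
  · rintro hf c ⟨_, k, rfl⟩
    refine (apply_homEquiv f k).trans (cone_ext _ _ _ _ (imIncl_incl _) (imIncl_incl _) fun x => ?_)
    rw [star_comp_imIncl, star_comp_imIncl, hf, Category.assoc]

theorem sub_of_of_iff : Sub (of γ) (of σ) ↔ γ.FactorsThrough σ :=
  (homEquiv γ σ).surjective.exists.trans (exists_congr fun _ => incl_homEquiv_iff)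

theorem of_eq_of_iff : of γ = of σ ↔ γ.FactorsThrough σ ∧ σ.FactorsThrough γ := by
  constructor
  · intro h
    exact ⟨sub_of_of_iff.1 (sub_of_eq h), sub_of_of_iff.1 (sub_of_eq h.symm)⟩
  · rintro ⟨⟨f, hf⟩, g, hg⟩
    exact NormalDual.ext (H_eq_of γ σ g f hg hf)

end NormalDual

theorem mem_MSet_of_iff {c : C} : c ∈ MSet (NormalDual.of γ) ↔ IsIso (γ.comp c) := by
  refine ⟨?_, fun hc => ⟨a, γ, rfl, hc⟩⟩
  rintro ⟨b, σ, h, hc⟩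
  obtain ⟨⟨f, hf⟩, g, hg⟩ := NormalDual.of_eq_of_iff.1 h
  have : IsIso f :=
    ⟨g, σ.cancel _ _ fun x => by rw [← Category.assoc, ← hf, ← hg, Category.comp_id],
      γ.cancel _ _ fun x => by rw [← Category.assoc, ← hg, ← hf, Category.comp_id]⟩
  rw [hf]
  infer_instance

theorem NormalCone.eq_of_of_eq_of {c : C} {ε ε' : NormalCone c} (hε : ε.comp c = 𝟙 c)
    (hε' : ε'.comp c = 𝟙 c) (h : NormalDual.of ε = NormalDual.of ε') : ε = ε' := by
  obtain ⟨⟨f, hf⟩, -⟩ := NormalDual.of_eq_of_iff.1 h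
  have hf_id : f = 𝟙 c := by rw [← hε, hf c, hε', Category.id_comp]
  exact NormalCone.ext (funext fun x => by rw [hf x, hf_id, Category.comp_id])

variable {D : Type u} [Category.{u} D] {Γ : D ⥤ NormalDual C} {c c' : C} {d d' : D}
  {ε : NormalCone c} {ε' : NormalCone c'}

theorem gammaCone_eq (h : EGamma Γ c d) (hε : ε.comp c = 𝟙 c) (hd : Γ.obj d = NormalDual.of ε) :
    gammaCone h = ε :=
  NormalCone.eq_of_of_eq_of (NormalCone.comp_apex_of_isIdempotentElem (gammaCone_spec h).1) hε
    ((gammaCone_spec h).2.symm.trans hd)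

theorem etaGamma_hom_eq (h : EGamma Γ c d) (hε : ε.comp c = 𝟙 c)
    (hd : Γ.obj d = NormalDual.of ε) :
    (etaGamma h).hom = NormalDual.Hom.nat (eqToHom hd) ≫ (eta ε).hom := by
  obtain rfl := gammaCone_eq h hε hd
  rw [NormalDual.nat_eqToHom]
  rfl

theorem commSquare_iff (h : EGamma Γ c d) (h' : EGamma Γ c' d') (hε : ε.comp c = 𝟙 c)
    (hε' : ε'.comp c' = 𝟙 c') (hd : Γ.obj d = NormalDual.of ε)
    (hd' : Γ.obj d' = NormalDual.of ε') {g : d ⟶ d'} {f : c' ⟶ c} :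
    CommSquare Γ h h' g f ↔
      Γ.map g = eqToHom hd ≫ NormalDual.homEquiv ε ε' f ≫ eqToHom hd'.symm := by
  have hnat : (Γ.map g = eqToHom hd ≫ NormalDual.homEquiv ε ε' f ≫ eqToHom hd'.symm) ↔
      (Γ.map g).nat = NormalDual.Hom.nat (eqToHom hd) ≫
        ((eta ε).hom ≫ coyoneda.map f.op ≫ (eta ε').inv) ≫
          NormalDual.Hom.nat (eqToHom hd'.symm) := NormalDual.Hom.ext_iff
  rw [hnat, CommSquare, etaGamma_hom_eq h hε hd, etaGamma_hom_eq h' hε' hd']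
  simp only [NormalDual.nat_eqToHom, ← Category.assoc]
  rw [← Iso.eq_comp_inv, comp_eqToHom_iff]

end NormalDual

/-! ### Triples -/

theorem Between.mul_left {S : Type u} [Semigroup S] {e f : Idem S} {u : S} (h : Between e u f) :
    (e : S) * u = u :=
  (between_iff.1 h).1

theorem Between.mul_right {S : Type u} [Semigroup S] {e f : Idem S} {u : S} (h : Between e u f) :
    u * (f : S) = u :=
  (between_iff.1 h).2

/-- Green's relation `ℛ` on the idempotents, `ℛ = ω^r ∩ (ω^r)⁻¹`. -/
def GreenR {S : Type u} [Semigroup S] (e f : Idem S) : Prop := OmegaR e f ∧ OmegaR f e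

namespace TripleModel

section Triples

variable {S : Type u} [Semigroup S] {C : Type u} [Category.{u} C] [Inclusions C] [TripleModel S C]
  {c d d' : C} {e f g h : Idem S} {u v : S}

theorem mor_comp_mor (he : of e = c) (hf : of f = d) (hu : Between e u f) (hg : of g = d)
    (hh : of h = d') (hv : Between g v h) :
    mor e u f he hf hu ≫ mor g v h hg hh hv = mor e (u * v) h he hh (between_comp hu hv) :=
  mor_comp _ _ _ _ _ _ _

theorem mor_inj (he : of e = c) (hf : of f = d) (hu : Between e u f) (hv : Between e v f) :
    mor e u f he hf hu = mor e v f he hf hv ↔ u = v := by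
  rw [mor_eq_iff, hv.mul_left]

theorem mor_eq_id_iff (he : of e = c) (hf : of f = c) (hu : Between e u f) :
    mor e u f he hf hu = 𝟙 c ↔ u = e := by
  rw [← mor_id e he (between_self e), mor_eq_iff, e.2]

theorem isIso_mor_iff (he : of e = c) (hf : of f = d) (hu : Between e u f) :
    IsIso (mor e u f he hf hu) ↔ ∃ v, Between f v e ∧ u * v = e ∧ v * u = f := by
  constructor
  · rintro ⟨m, hm₁, hm₂⟩
    obtain ⟨v, hv, rfl⟩ := mor_surjective f e hf he m
    rw [mor_comp_mor, mor_eq_id_iff] at hm₁ hm₂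
    exact ⟨v, hv, hm₁, hm₂⟩
  · rintro ⟨v, hv, huv, hvu⟩
    exact ⟨mor f v e hf he hv, by rwa [mor_comp_mor, mor_eq_id_iff],
      by rwa [mor_comp_mor, mor_eq_id_iff]⟩

theorem sub_of_iff : Sub (of e : C) (of f) ↔ OmegaL e f := by
  constructor
  · rintro ⟨j, hj⟩
    obtain ⟨g, h, hg, hh, hb, rfl⟩ := (incl_iff (S := S) j).1 hj
    calc (e : S) * f = e * (g * h) * f := by rw [hb.mul_right, green rfl hg]
      _ = e * (g * (h * f)) := by simp only [mul_assoc]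
      _ = e := by rw [green hh rfl, hb.mul_right, green rfl hg]
  · intro hef
    have hb : Between e (e : S) f := between_iff.2 ⟨e.2, hef⟩
    exact ⟨mor e e f rfl rfl hb, (incl_iff (S := S) _).2 ⟨e, f, rfl, rfl, hb, rfl⟩⟩

/-! ### Principal cones -/

theorem principalCone_comp_apex (he : of e = c) : (principalCone e he).comp c = 𝟙 c := by
  rw [principalCone_comp e he e he, mor_eq_id_iff, e.2]

theorem principalCone_comp_comp_mor (he : of e = c) (hf : of f = d) (hu : Between e u f)
    (hg : of g = d') :
    (principalCone e he).comp d' ≫ mor e u f he hf hu =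
      mor g (g * u) f hg hf (between_comp (between_self g) hu) := by
  rw [principalCone_comp e he g hg, mor_comp_mor, mor_inj, mul_assoc, hu.mul_left]

theorem isIso_principalCone_comp_iff (hf : of f = d) :
    IsIso ((principalCone f hf).comp c) ↔ ∃ e : Idem S, of e = c ∧ GreenR e f := by
  constructor
  · obtain ⟨g, rfl⟩ := of_surjective (S := S) c
    rw [principalCone_comp f hf g rfl, isIso_mor_iff]
    rintro ⟨v, hv, hgv, hvf⟩
    rw [mul_assoc, hv.mul_left] at hgv
    rw [← mul_assoc, hv.mul_right] at hvf
    have hv_idem : v * v = v := by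
      calc v * v = v * (g * v) := by rw [← mul_assoc, hv.mul_right]
        _ = v := by rw [hgv, hv.mul_right]
    exact ⟨⟨v, hv_idem⟩, of_eq_iff.2 ⟨hv.mul_right, hgv⟩, hv.mul_left, hvf⟩
  · rintro ⟨e, rfl, hfe, hef⟩
    rw [principalCone_comp f hf e rfl, isIso_mor_iff]
    refine ⟨e, between_iff.2 ⟨hfe, e.2⟩, ?_, ?_⟩
    · rw [mul_assoc, hfe, e.2]
    · rw [hef, hef]

theorem omegaR_of_factorsThrough (he : OmegaR e h) (hf : OmegaR f h) {hc : of e = c}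
    {hd : of f = d} (hef : (principalCone e hc).FactorsThrough (principalCone f hd)) :
    OmegaR e f := by
  obtain ⟨k, hk⟩ := hef
  obtain ⟨w, hw, rfl⟩ := mor_surjective f e hd hc k
  have hmor := hk (of h)
  rw [principalCone_comp_comp_mor hd hc hw rfl, principalCone_comp e hc h rfl, mor_inj] at hmor
  have hhw : (h : S) * w = w := by rw [← hw.mul_left, ← mul_assoc, hf]
  have hew : (e : S) = w := he.symm.trans (hmor.trans hhw)
  rw [OmegaR, hew, hw.mul_left]

/-- If `γ` is `r^h` followed by `(h, w, f)` and a component of `γ` has the inverse `(f, v, g)`, then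
the idempotent is `w v`. -/
theorem exists_omegaR_of_factorsThrough [NormalCategory C] {γ : NormalCone d} (hh : of h = c)
    (hγ : γ.FactorsThrough (principalCone h hh)) :
    ∃ e : Idem S, OmegaR e h ∧
      NormalDual.of γ = NormalDual.of (principalCone (C := C) e rfl) := by
  obtain ⟨k, hk⟩ := hγ
  obtain ⟨f, hf⟩ := of_surjective (S := S) d
  obtain ⟨w, hw, rfl⟩ := mor_surjective h f hh hf k
  obtain ⟨b, hb⟩ := γ.exists_iso
  obtain ⟨g, hg⟩ := of_surjective (S := S) b
  rw [hk, principalCone_comp_comp_mor hh hf hw hg, isIso_mor_iff] at hb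
  obtain ⟨v, hv, -, hvw⟩ := hb
  rw [← mul_assoc, hv.mul_right] at hvw
  have hwvw : w * v * w = w := by rw [mul_assoc, hvw, hw.mul_right]
  have hvwv : v * (w * v) = v := by rw [← mul_assoc, hvw, hv.mul_left]
  let e : Idem S := ⟨w * v, by rw [← mul_assoc, hwvw]⟩
  have hwe : Between e w f := between_iff.2 ⟨hwvw, hw.mul_right⟩
  have hve : Between f v e := between_iff.2 ⟨hv.mul_left, hvwv⟩
  refine ⟨e, (mul_assoc _ _ _).symm.trans (congrArg (· * v) hw.mul_left),
    NormalDual.of_eq_of_iff.2 ⟨⟨mor e w f rfl hf hwe, fun x => ?_⟩,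
      ⟨mor f v e hf rfl hve, fun x => ?_⟩⟩⟩
  · rw [hk, principalCone_comp_comp_mor hh hf hw (of_rep x),
      principalCone_comp_comp_mor rfl hf hwe (of_rep x)]
  · rw [hk, principalCone_comp_comp_mor hh hf hw (of_rep x), mor_comp_mor,
      principalCone_comp e rfl _ (of_rep x), mor_inj, mul_assoc]

end Triples

/-! ### The cross-connection and its dual -/

section Gamma

variable {S T : Type u} [Semigroup S] [Semigroup T] (φ : T ≃* Sᵐᵒᵖ)

theorem unop_map_mul (s t : T) : (φ (s * t)).unop = (φ t).unop * (φ s).unop := by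
  rw [map_mul, MulOpposite.unop_mul]

theorem unop_map_injective : Function.Injective fun t => (φ t).unop :=
  MulOpposite.unop_injective.comp φ.injective

theorem unop_map_surjective : Function.Surjective fun t => (φ t).unop :=
  MulOpposite.unop_surjective.comp φ.surjective

theorem antiIdem_surjective : Function.Surjective (antiIdem φ) := by
  rintro ⟨p, hp⟩
  obtain ⟨t, rfl⟩ := unop_map_surjective φ p
  exact ⟨⟨t, unop_map_injective φ ((unop_map_mul φ t t).trans hp)⟩, rfl⟩

variable {e e' f : Idem T} {u : T}

theorem omegaR_antiIdem_iff : OmegaR (antiIdem φ e) (antiIdem φ f) ↔ OmegaL e f := by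
  rw [OmegaR, OmegaL, ← (unop_map_injective φ).eq_iff, unop_map_mul]
  rfl

theorem greenR_antiIdem_iff : GreenR (antiIdem φ e) (antiIdem φ f) ↔ GreenL e f :=
  and_congr (omegaR_antiIdem_iff φ) (omegaR_antiIdem_iff φ)

theorem between_anti_iff :
    Between (antiIdem φ f) (φ u).unop (antiIdem φ e) ↔ Between e u f := by
  refine ⟨fun h => between_iff.2 ⟨?_, ?_⟩, between_anti φ⟩
  · exact unop_map_injective φ ((unop_map_mul φ e u).trans h.mul_right)
  · exact unop_map_injective φ ((unop_map_mul φ u f).trans h.mul_left)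

variable {C D : Type u} [Category.{u} C] [Inclusions C] [NormalCategory C] [TripleModel S C]
  [Category.{u} D] [Inclusions D] [TripleModel T D]

theorem gamma_map_eq (hu : Between e u f) :
    (gamma φ C D).map (mor e u f rfl rfl hu) =
      eqToHom (gamma_obj φ C e) ≫
        NormalDual.homEquiv (principalCone (antiIdem φ e) rfl) (principalCone (antiIdem φ f) rfl)
          (mor (antiIdem φ f) (φ u).unop (antiIdem φ e) rfl rfl (between_anti φ hu)) ≫
        eqToHom (gamma_obj φ C f).symm :=
  gamma_map φ C e u f hu

theorem inclusionPreserving_gamma : InclusionPreserving (gamma φ C D) := by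
  intro a b j hj
  obtain ⟨e, f, rfl, rfl, hb, rfl⟩ := (incl_iff (S := T) j).1 hj
  rw [gamma_map_eq, incl_eqToHom_comp_comp_eqToHom_iff, NormalDual.incl_homEquiv_iff]
  intro x
  rw [principalCone_comp_comp_mor rfl rfl (between_anti φ hb) (of_rep x),
    principalCone_comp _ rfl _ (of_rep x)]
  rfl

theorem faithful_gamma : (gamma φ C D).Faithful where
  map_injective {d d'} l m hlm := by
    obtain ⟨e, rfl⟩ := of_surjective (S := T) d
    obtain ⟨f, rfl⟩ := of_surjective (S := T) d'
    obtain ⟨u, hu, rfl⟩ := mor_surjective e f rfl rfl l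
    obtain ⟨v, hv, rfl⟩ := mor_surjective e f rfl rfl m
    rw [gamma_map_eq, gamma_map_eq, cancel_epi, cancel_mono, EmbeddingLike.apply_eq_iff_eq,
      mor_inj] at hlm
    rw [mor_inj]
    exact unop_map_injective φ hlm

theorem full_gamma : (gamma φ C D).Full where
  map_surjective {d d'} m := by
    obtain ⟨e, rfl⟩ := of_surjective (S := T) d
    obtain ⟨f, rfl⟩ := of_surjective (S := T) d'
    obtain ⟨k, hk⟩ := (NormalDual.homEquiv _ _).surjective
      (eqToHom (gamma_obj φ C e).symm ≫ m ≫ eqToHom (gamma_obj φ C f))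
    obtain ⟨w, hw, rfl⟩ := mor_surjective (antiIdem φ f) (antiIdem φ e) rfl rfl k
    obtain ⟨u, rfl⟩ := unop_map_surjective φ w
    refine ⟨mor e u f rfl rfl ((between_anti_iff φ).1 hw), ?_⟩
    rw [gamma_map_eq, hk]
    simp only [Category.assoc, eqToHom_trans, eqToHom_trans_assoc, eqToHom_refl, Category.id_comp,
      Category.comp_id]

theorem ideal_bijOn_gamma (d : D) :
    Set.BijOn (gamma φ C D).obj {d' | Sub d' d} {F | Sub F ((gamma φ C D).obj d)} := by
  obtain ⟨h, rfl⟩ := of_surjective (S := T) d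
  refine ⟨?_, ?_, ?_⟩
  · rintro d' ⟨j, hj⟩
    exact ⟨_, inclusionPreserving_gamma φ j hj⟩
  · intro d₁ hd₁ d₂ hd₂ hobj
    obtain ⟨e, rfl⟩ := of_surjective (S := T) d₁
    obtain ⟨f, rfl⟩ := of_surjective (S := T) d₂
    have he := (omegaR_antiIdem_iff φ).2 (sub_of_iff.1 hd₁)
    have hf := (omegaR_antiIdem_iff φ).2 (sub_of_iff.1 hd₂)
    rw [gamma_obj, gamma_obj, NormalDual.of_eq_of_iff] at hobj
    exact of_eq_iff.2 ((greenR_antiIdem_iff φ).1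
      ⟨omegaR_of_factorsThrough he hf hobj.1, omegaR_of_factorsThrough hf he hobj.2⟩)
  · rintro ⟨_, a, γ, rfl⟩ hγ
    rw [Set.mem_ofPred_eq, gamma_obj] at hγ
    obtain ⟨p, hp, hγp⟩ := exists_omegaR_of_factorsThrough rfl (NormalDual.sub_of_of_iff.1 hγ)
    obtain ⟨e, rfl⟩ := antiIdem_surjective φ p
    exact ⟨of e, sub_of_iff.2 ((omegaR_antiIdem_iff φ).1 hp), (gamma_obj φ C e).trans hγp.symm⟩

variable {c c' : C} {d d' : D} {p p' : Idem S} {w : S}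

/-- The idempotent `p` of `S` is kept apart from `antiIdem φ e` so that the condition is symmetric
in `Γ` and its dual. -/
theorem eGamma_gamma_iff :
    EGamma (gamma φ C D) c d ↔
      ∃ (e : Idem T) (p : Idem S), antiIdem φ e = p ∧ of p = c ∧ of e = d := by
  obtain ⟨f, rfl⟩ := of_surjective (S := T) d
  rw [EGamma, gamma_obj, mem_MSet_of_iff, isIso_principalCone_comp_iff]
  constructor
  · rintro ⟨p, hc, hp⟩
    obtain ⟨e, rfl⟩ := antiIdem_surjective φ p
    exact ⟨e, _, rfl, hc, of_eq_iff.2 ((greenR_antiIdem_iff φ).1 hp)⟩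
  · rintro ⟨e, _, rfl, hc, hef⟩
    exact ⟨_, hc, (greenR_antiIdem_iff φ).2 (of_eq_iff.1 hef)⟩

theorem isCrossConnection_gamma : IsCrossConnection (gamma φ C D) where
  localIso := ⟨inclusionPreserving_gamma φ, full_gamma φ, faithful_gamma φ, ideal_bijOn_gamma φ⟩
  exists_mem c := by
    obtain ⟨p, hp⟩ := of_surjective (S := S) c
    obtain ⟨e, he⟩ := antiIdem_surjective φ p
    exact ⟨of e, (eGamma_gamma_iff φ).2 ⟨e, p, he, hp, rfl⟩⟩

theorem gammaCone_gamma (h : EGamma (gamma φ C D) c d) (hp : antiIdem φ e = p) (hc : of p = c)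
    (hd : of e = d) : gammaCone h = principalCone p hc := by
  subst hp hc hd
  exact gammaCone_eq h (principalCone_comp_apex rfl) (gamma_obj φ C e)

theorem commSquare_gamma_iff (h : EGamma (gamma φ C D) c d) (h' : EGamma (gamma φ C D) c' d')
    (hp : antiIdem φ e = p) (hp' : antiIdem φ e' = p') (hc : of p = c) (hd : of e = d)
    (hc' : of p' = c') (hd' : of e' = d') (hu : Between e u e') (hw : Between p' w p) :
    CommSquare (gamma φ C D) h h' (mor e u e' hd hd' hu) (mor p' w p hc' hc hw) ↔
      (φ u).unop = w := by
  subst hp hp' hc hd hc' hd'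
  rw [commSquare_iff h h' (principalCone_comp_apex rfl) (principalCone_comp_apex rfl)
    (gamma_obj φ C e) (gamma_obj φ C e'), gamma_map_eq, cancel_epi, cancel_mono,
    EmbeddingLike.apply_eq_iff_eq, mor_inj]

theorem unop_map_eq_iff {ψ : S ≃* Tᵐᵒᵖ} (hψ : ∀ t, (ψ (φ t).unop).unop = t) {s : S} {t : T} :
    (ψ s).unop = t ↔ (φ t).unop = s := by
  rw [← (unop_map_injective ψ).eq_iff, hψ, eq_comm]

theorem antiIdem_eq_iff {ψ : S ≃* Tᵐᵒᵖ} (hψ : ∀ t, (ψ (φ t).unop).unop = t) :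
    antiIdem ψ p = e ↔ antiIdem φ e = p :=
  Subtype.ext_iff.trans ((unop_map_eq_iff φ hψ).trans (Subtype.ext_iff (a1 := antiIdem φ e)).symm)

theorem isDual_gamma [NormalCategory D] (ψ : S ≃* Tᵐᵒᵖ) (hψ : ∀ t, (ψ (φ t).unop).unop = t) :
    IsDual (gamma φ C D) (gamma ψ D C) where
  isCrossConnection := isCrossConnection_gamma ψ
  mem_iff c d := by
    rw [eGamma_gamma_iff, eGamma_gamma_iff, exists_comm]
    simp only [antiIdem_eq_iff φ hψ, and_comm]
  square_iff {c c' d d'} h h' k k' m l := by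
    obtain ⟨e, p, hp, hc, hd⟩ := (eGamma_gamma_iff φ).1 h
    obtain ⟨e', p', hp', hc', hd'⟩ := (eGamma_gamma_iff φ).1 h'
    obtain ⟨w, hw, rfl⟩ := mor_surjective p p' hc hc' m
    obtain ⟨u, hu, rfl⟩ := mor_surjective e' e hd' hd l
    rw [commSquare_gamma_iff φ h' h hp' hp, commSquare_gamma_iff ψ k k'
      ((antiIdem_eq_iff φ hψ).2 hp) ((antiIdem_eq_iff φ hψ).2 hp'), unop_map_eq_iff φ hψ]
  cone_comp {c c' d d'} h h' k := by
    obtain ⟨e, p, hp, hc, hd⟩ := (eGamma_gamma_iff φ).1 h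
    obtain ⟨e', p', hp', hc', hd'⟩ := (eGamma_gamma_iff φ).1 h'
    rw [gammaCone_gamma ψ k ((antiIdem_eq_iff φ hψ).2 hp) hd hc, gammaCone_gamma φ h' hp' hc' hd',
      principalCone_comp _ _ _ hd', principalCone_comp _ _ _ hc,
      commSquare_gamma_iff φ h' h hp' hp, unop_map_mul, ← hp, ← hp']
    rfl

end Gamma

/-! ### Functors which preserve triples -/

section Functor

variable {S : Type u} [Semigroup S] {C C' C'' : Type u}
  [Category.{u} C] [Inclusions C] [TripleModel S C]
  [Category.{u} C'] [Inclusions C'] [TripleModel S C']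
  [Category.{u} C''] [Inclusions C''] [TripleModel S C'']

variable (S) in
/-- The functor `F` maps the object of `e` to the object of `e` and the morphism of `(e, u, f)` to
the morphism of `(e, u, f)`, as `𝔏` and `ℜ` do. -/
structure PreservesTriples (F : C ⥤ C') : Prop where
  obj_of : ∀ {c : C} {e : Idem S}, of e = c → of e = F.obj c
  map_mor : ∀ {c d : C} (e : Idem S) (u : S) (f : Idem S) (he : of e = c) (hf : of f = d)
    (hu : Between e u f), F.map (mor e u f he hf hu) = mor e u f (obj_of he) (obj_of hf) hu

theorem PreservesTriples.comp {F : C ⥤ C'} {G : C' ⥤ C''} (hF : PreservesTriples S F)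
    (hG : PreservesTriples S G) : PreservesTriples S (F ⋙ G) where
  obj_of he := hG.obj_of (hF.obj_of he)
  map_mor e u f he hf hu := by rw [Functor.comp_map, hF.map_mor, hG.map_mor]

variable (S C) in
theorem preservesTriples_id : PreservesTriples S (𝟭 C) where
  obj_of he := he
  map_mor _ _ _ _ _ _ := rfl

theorem eqToHom_comp_mor_comp_eqToHom {c c' d d' : C} (hc : c' = c) (hd : d = d') {e f : Idem S}
    {u : S} (he : of e = c) (hf : of f = d) (hu : Between e u f) :
    eqToHom hc ≫ mor e u f he hf hu ≫ eqToHom hd =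
      mor e u f (he.trans hc.symm) (hf.trans hd) hu := by
  subst hc hd
  simp only [eqToHom_refl, Category.comp_id, Category.id_comp]

theorem PreservesTriples.eq {F G : C ⥤ C'} (hF : PreservesTriples S F)
    (hG : PreservesTriples S G) : F = G := by
  have hobj (c : C) : F.obj c = G.obj c :=
    (hF.obj_of (of_rep (S := S) c)).symm.trans (hG.obj_of (of_rep c))
  refine CategoryTheory.Functor.ext hobj fun c d m => ?_
  obtain ⟨u, hu, rfl⟩ := mor_surjective (rep S c) (rep S d) (of_rep c) (of_rep d) m
  rw [hF.map_mor, hG.map_mor, eqToHom_comp_mor_comp_eqToHom]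

theorem PreservesTriples.inclusionPreserving {F : C ⥤ C'} (hF : PreservesTriples S F) :
    InclusionPreserving F := by
  intro a b j hj
  obtain ⟨e, f, he, hf, hb, rfl⟩ := (incl_iff (S := S) j).1 hj
  rw [hF.map_mor]
  exact (incl_iff (S := S) _).2 ⟨e, f, _, _, hb, rfl⟩

theorem PreservesTriples.map_principalCone {F : C ⥤ C'} (hF : PreservesTriples S F) {e : Idem S}
    {c : C} (he : of e = c) (a : C) :
    F.map ((principalCone e he).comp a) = (principalCone e (hF.obj_of he)).comp (F.obj a) := by
  rw [principalCone_comp _ _ _ (of_rep a), principalCone_comp _ _ _ (hF.obj_of (of_rep a)),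
    hF.map_mor]

variable (S) in
/-- The middle entry `u` of the triple `(e, u, f)` of a morphism `c ⟶ d`, where `e` and `f` are the
chosen representatives of `c` and `d`. -/
noncomputable def label {c d : C} (m : c ⟶ d) : S :=
  (mor_surjective (rep S c) (rep S d) (of_rep c) (of_rep d) m).choose

theorem between_label {c d : C} (m : c ⟶ d) : Between (rep S c) (label S m) (rep S d) :=
  (mor_surjective (rep S c) (rep S d) (of_rep c) (of_rep d) m).choose_spec.choose

theorem mor_label {c d : C} (m : c ⟶ d) :
    mor (rep S c) (label S m) (rep S d) (of_rep c) (of_rep d) (between_label m) = m :=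
  (mor_surjective (rep S c) (rep S d) (of_rep c) (of_rep d) m).choose_spec.choose_spec.symm

theorem label_mor {c d : C} {e f : Idem S} {u : S} (he : of e = c) (hf : of f = d)
    (hu : Between e u f) : label S (mor e u f he hf hu) = rep S c * u :=
  (mor_eq_iff _ _ _ _ _ _).1 (mor_label _)

theorem label_id (c : C) : label S (𝟙 c) = rep S c :=
  (mor_eq_id_iff _ _ _).1 (mor_label _)

theorem label_comp {a b c : C} (l : a ⟶ b) (m : b ⟶ c) :
    label S (l ≫ m) = label S l * label S m := by
  conv_lhs => rw [← mor_label (S := S) l, ← mor_label (S := S) m]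
  rw [mor_comp_mor, label_mor, ← mul_assoc, (between_label l).mul_left]

variable (S C C') in
/-- The functor between two categories described by triples of the same semigroup which preserves
triples; it is unique, see `PreservesTriples.eq`. -/
noncomputable def comparison : C ⥤ C' where
  obj c := of (rep S c)
  map {c d} m := mor (rep S c) (label S m) (rep S d) rfl rfl (between_label m)
  map_id c := by rw [mor_eq_id_iff, label_id]
  map_comp l m := by rw [mor_comp_mor, mor_inj, label_comp]

variable (S C C') in
theorem preservesTriples_comparison : PreservesTriples S (comparison S C C') where
  obj_of {c _} he := of_eq_iff.2 (of_eq_iff.1 (he.trans (of_rep c).symm))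
  map_mor _ _ _ _ _ _ := (mor_eq_iff _ _ _ _ _ _).2 (label_mor _ _ _)

theorem PreservesTriples.comp_comparison {F : C ⥤ C'} (hF : PreservesTriples S F) :
    F ⋙ comparison S C' C = 𝟭 C :=
  (hF.comp (preservesTriples_comparison S C' C)).eq (preservesTriples_id S C)

theorem PreservesTriples.comparison_comp {F : C ⥤ C'} (hF : PreservesTriples S F) :
    comparison S C' C ⋙ F = 𝟭 C' :=
  ((preservesTriples_comparison S C' C).comp hF).eq (preservesTriples_id S C')

theorem PreservesTriples.isNormalCategoryIso {F : C ⥤ C'} (hF : PreservesTriples S F) :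
    IsNormalCategoryIso F :=
  isNormalCategoryIso_of_inverse hF.inclusionPreserving
    (preservesTriples_comparison S C' C).inclusionPreserving hF.comp_comparison hF.comparison_comp

end Functor

section Morphism

variable {S T : Type u} [Semigroup S] [Semigroup T] (φ : T ≃* Sᵐᵒᵖ) (ψ : S ≃* Tᵐᵒᵖ)
  {C C' D D' : Type u}
  [Category.{u} C] [Inclusions C] [NormalCategory C] [TripleModel S C]
  [Category.{u} C'] [Inclusions C'] [NormalCategory C'] [TripleModel S C']
  [Category.{u} D] [Inclusions D] [TripleModel T D]
  [Category.{u} D'] [Inclusions D'] [TripleModel T D']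
  {F : C ⥤ C'} {G : D ⥤ D'}

theorem PreservesTriples.eGamma (hF : PreservesTriples S F) (hG : PreservesTriples T G) {c : C}
    {d : D} (h : EGamma (gamma φ C D) c d) :
    EGamma (gamma φ C' D') (F.obj c) (G.obj d) := by
  obtain ⟨e, p, hp, hc, hd⟩ := (eGamma_gamma_iff φ).1 h
  exact (eGamma_gamma_iff φ).2 ⟨e, p, hp, hF.obj_of hc, hG.obj_of hd⟩

variable [NormalCategory D] [NormalCategory D']

theorem PreservesTriples.isCrossConnectionMorphism (hF : PreservesTriples S F)
    (hG : PreservesTriples T G) :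
    IsCrossConnectionMorphism (gamma φ C D) (gamma ψ D C) (gamma φ C' D') (gamma ψ D' C') F G where
  inclusionPreserving_left := hF.inclusionPreserving
  inclusionPreserving_right := hG.inclusionPreserving
  map_mem h := hF.eGamma φ hG h
  map_cone {c d} h c' := by
    obtain ⟨e, p, hp, hc, hd⟩ := (eGamma_gamma_iff φ).1 h
    rw [gammaCone_gamma φ _ hp hc hd, gammaCone_gamma φ _ hp (hF.obj_of hc) (hG.obj_of hd),
      hF.map_principalCone]
  map_transpose {c c' d d'} _ _ m l := by
    rintro ⟨k, k', h⟩
    refine ⟨hG.eGamma ψ hF k, hG.eGamma ψ hF k', ?_⟩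
    obtain ⟨e, p, hp, hd, hc⟩ := (eGamma_gamma_iff ψ).1 k
    obtain ⟨e', p', hp', hd', hc'⟩ := (eGamma_gamma_iff ψ).1 k'
    obtain ⟨u, hu, rfl⟩ := mor_surjective e e' hc hc' m
    obtain ⟨w, hw, rfl⟩ := mor_surjective p' p hd' hd l
    rw [commSquare_gamma_iff ψ k k' hp hp'] at h
    rwa [hF.map_mor, hG.map_mor, commSquare_gamma_iff ψ _ _ hp hp']

theorem PreservesTriples.isCrossConnectionIso (hF : PreservesTriples S F)
    (hG : PreservesTriples T G) :
    IsCrossConnectionIso (gamma φ C D) (gamma ψ D C) (gamma φ C' D') (gamma ψ D' C') F G :=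
  ⟨hF.isCrossConnectionMorphism φ ψ hG, comparison S C' C, comparison T D' D,
    (preservesTriples_comparison S C' C).isCrossConnectionMorphism φ ψ
      (preservesTriples_comparison T D' D),
    hF.comp_comparison, hF.comparison_comp, hG.comp_comparison, hG.comparison_comp⟩

end Morphism

end TripleModel

theorem preservesTriples_functorL (S : Type u) [Semigroup S] [IsRegularSemigroup S] :
    TripleModel.PreservesTriples S (functorL S) where
  obj_of he := by
    subst he
    rfl
  map_mor e u f he hf hu := by
    subst he hf
    exact functorL_map_r e u f hu

end CrossConn

theorem mainTheorem2 (S : Type u) [Semigroup S] [CrossConn.IsRegularSemigroup S] :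
    -- the four categories are normal categories
    CrossConn.NormalCategory (CrossConn.LG S) ∧ CrossConn.NormalCategory (CrossConn.RG S) ∧
    CrossConn.NormalCategory (CrossConn.LS S) ∧ CrossConn.NormalCategory (CrossConn.RS S) ∧
    -- `Γ_G` and `Γ_S` are cross-connections, with duals `Δ_G` and `Δ_S`
    CrossConn.IsCrossConnection (CrossConn.GammaG S) ∧
    CrossConn.IsDual (CrossConn.GammaG S) (CrossConn.DeltaG S) ∧
    CrossConn.IsCrossConnection (CrossConn.GammaS S) ∧
    CrossConn.IsDual (CrossConn.GammaS S) (CrossConn.DeltaS S) ∧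
    -- `𝔏` and `ℜ` are isomorphisms of normal categories
    CrossConn.IsNormalCategoryIso (CrossConn.functorL S) ∧
    CrossConn.IsNormalCategoryIso (CrossConn.functorR S) ∧
    -- `(𝔏, ℜ)` is an isomorphism of cross-connections
    CrossConn.IsCrossConnectionIso (CrossConn.GammaG S) (CrossConn.DeltaG S)
      (CrossConn.GammaS S) (CrossConn.DeltaS S) (CrossConn.functorL S) (CrossConn.functorR S) := by
  have hL := CrossConn.preservesTriples_functorL S
  have hR := CrossConn.preservesTriples_functorL Sᵐᵒᵖ
  exact ⟨inferInstance, inferInstance, inferInstance, inferInstance,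
    CrossConn.TripleModel.isCrossConnection_gamma _,
    CrossConn.TripleModel.isDual_gamma _ _ fun _ => rfl,
    CrossConn.TripleModel.isCrossConnection_gamma _,
    CrossConn.TripleModel.isDual_gamma _ _ fun _ => rfl,
    hL.isNormalCategoryIso, hR.isNormalCategoryIso, hL.isCrossConnectionIso _ _ hR⟩
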